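/- Let $n,m\in\mathbb R$, $\mathcal B>0$, $X>0$, $q=m-n+1$, and let $H$ be any function that is twice differentiable on $(0,\infty)$ with $H''(y)=\mathcal B y^{q-1}$ there. For an $X$-periodic function $\ell>0$ put $$\mathcal E(\ell)=\int_0^X\Big[\tfrac12(\ell')^2-H(\ell)\Big]dx .$$ Let $h_{\rm ss}\in C^4(\mathbb R)$ be a non-constant positive $X$-periodic steady state of $h_t=-(h^nh_{xxx})_x-\mathcal B(h^mh_x)_x$. Call $h_{\rm ss}$ *energy unstable in the direction $u$* if $u$ is smooth, $X$-periodic, has mean value zero, and $\mathcal E(h_{\rm ss}+\varepsilon u)<\mathcal E(h_{\rm ss})$ for all sufficiently small $\varepsilon>0$; call it *energy unstable* if such a $u$ exists. For $\alpha\in(0,1)$ let $k_\alpha$ be the unique smooth positive periodic solution of $k''+\frac{k^q-1}{q}=0$ ($k''+\log k=0$ if $q=0$) with $k(0)=\alpha$, $k'(0)=0$. Let $P(\alpha)$ be its least period, $A(\alpha)=\int_0^{P(\alpha)}k_\alpha\,dx$, $E(\alpha)=P(\alpha)^{3-q}A(\alpha)^{q-1}$, and $$K_\alpha(x)=\frac{P(\alpha)}{A(\alpha)}\,k_\alpha(P(\alpha)x),\qquad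 \kappa_\alpha(x)=\frac{\partial}{\partial\alpha}K_\alpha(x).$$ Let $x_0$ be a point where $h_{\rm ss}$ attains its minimum, and put $\tilde h(x)=h_{\rm ss}(x+x_0)$. We say that $h_{\rm ss}$ *rescales to* $k_\alpha$ if for some constant $D$ (with $D>0$ if $q\ne0$) one has $$\tilde h''+\frac{\mathcal B\tilde h^q-D}{q}=0,\qquad k_\alpha(x)=\Big(\frac{\mathcal B}{D}\Big)^{1/q}\tilde h\Big(\Big(\frac{D}{\mathcal B}\Big)^{1/2q}\frac{x}{D^{1/2}}\Big)\qquad(q\neq0),$$ $$\tilde h''+\mathcal B\log\tilde h-D=0,\qquad k_\alpha(x)=e^{-D/\mathcal B}\,\tilde h\Big(e^{D/2\mathcal B}\frac{x}{\mathcal B^{1/2}}\Big)\qquad(q=0).$$ Then $h_{\rm ss}$ rescales to $k_\alpha$ for exactly one $\alpha\in(0,1)$, and, for this $\alpha$: 1. If $q<1$ or $q>2$, then $h_{\rm ss}$ is energy unstable in each of the directions $\pm h_{\rm ss}'$ and $\pm h_{\rm ss}''$. 2. If $q=2$, then $h_{\rm ss}$ is energy unstable, namely in the direction $-h_{\rm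 ss}''$. 3. If $q>1$ and $E'(\alpha)>0$, then $h_{\rm ss}$ is energy unstable. Namely, $K_a(x)$ is differentiable in $a$ at $a=\alpha$ for every $x$, and $h_{\rm ss}$ is energy unstable in both of the directions $u(x)=\pm\kappa_\alpha\big((x-x_0)/X_0\big)$, where $X_0$ is the least period of $h_{\rm ss}$. -/

import Mathlib

open Set Filter Topology
open scoped ContDiff

noncomputable section

namespace ThinFilm

/-- `h` satisfies classically the steady state equation of the evolution
`h_t = -(f(h) h_xxx)_x - (g(h) h_x)_x`. -/
def IsSteadyState (f g h : ℝ → ℝ) : Prop :=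
  ∀ x : ℝ, -deriv (fun y => f (h y) * iteratedDeriv 3 h y) x
    - deriv (fun y => g (h y) * deriv h y) x = 0

/-- `H` is twice differentiable on `(0, ∞)` with `H'' = g / f` there. -/
def IsPotential (f g H : ℝ → ℝ) : Prop :=
  ∀ y : ℝ, 0 < y → DifferentiableAt ℝ H y ∧ HasDerivAt (deriv H) (g y / f y) y

/-- The energy `∫₀^X [ (ℓ')² / 2 - H(ℓ) ] dx`. -/
def energy (H : ℝ → ℝ) (X : ℝ) (ℓ : ℝ → ℝ) : ℝ :=
  ∫ x in (0 : ℝ)..X, ((1 / 2) * (deriv ℓ x) ^ 2 - H (ℓ x))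

/-- `u` is a smooth `X`-periodic mean-zero perturbation that decreases the energy of `h`:
`energy (h + ε u) < energy h` for all small `ε > 0`. -/
structure EnergyUnstableInDirection (H : ℝ → ℝ) (X : ℝ) (h u : ℝ → ℝ) : Prop where
  smooth : ContDiff ℝ ∞ u
  periodic : Function.Periodic u X
  mean_zero : ∫ x in (0 : ℝ)..X, u x = 0
  decreases : ∀ᶠ ε in 𝓝[>] (0 : ℝ), energy H X (fun x => h x + ε * u x) < energy H X h

/-- Energy instability with respect to zero-mean perturbations at period `X`. -/
def EnergyUnstable (H : ℝ → ℝ) (X : ℝ) (h : ℝ → ℝ) : Prop :=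
  ∃ u : ℝ → ℝ, EnergyUnstableInDirection H X h u

/-- The least positive period (for a non-constant continuous periodic function the infimum is
attained). -/
def leastPeriod (k : ℝ → ℝ) : ℝ :=
  sInf {p : ℝ | 0 < p ∧ Function.Periodic k p}

/-- `k` is a smooth positive periodic solution of the canonical oscillator equation
`k'' + (k^q - 1)/q = 0` (`k'' + log k = 0` if `q = 0`) with `k(0) = α` and `k'(0) = 0`. -/
structure IsCanonicalSolution (q α : ℝ) (k : ℝ → ℝ) : Prop where
  smooth : ContDiff ℝ ∞ k
  pos : ∀ x, 0 < k x
  periodic : ∃ p : ℝ, 0 < p ∧ Function.Periodic k p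
  ode : ∀ x, deriv (deriv k) x +
    (if q = 0 then Real.log (k x) else (k x ^ q - 1) / q) = 0
  init : k 0 = α
  init_deriv : deriv k 0 = 0

open Classical in
/-- The solution `k_α` of the canonical oscillator equation. For `0 < α < 1` it exists and is
unique; the value where no solution exists is irrelevant. -/
def kSol (q α : ℝ) : ℝ → ℝ :=
  if hk : ∃ k, IsCanonicalSolution q α k then hk.choose else fun _ => 0

/-- The least period `P(α)` of `k_α`. -/
def P (q α : ℝ) : ℝ := leastPeriod (kSol q α)

/-- The area `A(α)` under one period of `k_α`. -/
def A (q α : ℝ) : ℝ := ∫ x in (0 : ℝ)..P q α, kSol q α x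

/-- `E(α) = P(α)^(3-q) A(α)^(q-1)`. -/
def E (q α : ℝ) : ℝ := P q α ^ (3 - q) * A q α ^ (q - 1)

/-- `K_α(x) = (P(α)/A(α)) k_α(P(α) x)`, of period one and mean value one. -/
def K (q α x : ℝ) : ℝ := P q α / A q α * kSol q α (P q α * x)

/-- `κ_α(x) = ∂K_α(x)/∂α`. -/
def kappa (q α x : ℝ) : ℝ := deriv (fun a => K q a x) α

/-- The rescaling of `h` that removes the constants `B` and `D` from the oscillator equation
`h'' + (B h^q - D)/q = 0` (`h'' + B log h - D = 0` if `q = 0`). -/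
def rescale (q B D : ℝ) (h : ℝ → ℝ) (x : ℝ) : ℝ :=
  if q = 0 then Real.exp (-D / B) * h (Real.exp (D / (2 * B)) * (x / B ^ (1 / 2 : ℝ)))
  else (B / D) ^ (1 / q) * h ((D / B) ^ (1 / (2 * q)) * (x / D ^ (1 / 2 : ℝ)))

/-- `h` solves the oscillator equation for some constant `D` (with `D > 0` if `q ≠ 0`), and the
corresponding rescaling of `h` is `k_α`. -/
def RescalesTo (q B : ℝ) (h : ℝ → ℝ) (α : ℝ) : Prop :=
  ∃ D : ℝ, (q ≠ 0 → 0 < D) ∧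
    (∀ x, deriv (deriv h) x +
      (if q = 0 then B * Real.log (h x) - D else (B * h x ^ q - D) / q) = 0) ∧
    ∀ x, rescale q B D h x = kSol q α x

end ThinFilm

end

noncomputable section

namespace ThinFilm

/-! ### Periodic functions and smoothness of solutions of second order equations -/

/-! The flux of a steady state is the constant `h^n (h''' + B h^(q-1) h')`. The bracket is the
derivative of a periodic function, so it vanishes somewhere, hence everywhere. Thus `h` solves a
second order oscillator equation, which a dilation of `h` and `x` turns into the canonical one.

Since `h'' + H'(h)` is constant, the first variation of the energy vanishes on mean-zero directions.
`exists_energy_le` expands the energy to fourth order in `ε`, and `energyUnstableInDirection`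
concludes as soon as the first nonvanishing variation among the second, third and fourth is
negative. For `u = ±h'` the second and third variations are integrals of exact derivatives, and the
fourth is a negative multiple of `(q-1)(q-2) ∫ h^(q-3) (h')^4`. For `u = ±h''` the second variation
is already a negative multiple of that quantity. At `q = 2` it is zero and the third variation,
being odd in `u`, selects the direction `-h''`.

For the direction `κ`, put `F = (k^q - 1)/q`. Differentiating the family `K` in `α` gives, in the
time variable of `k`, a periodic mean-zero `v` with `v'' + k^(q-1) v = M (l - e F)`, where `M =
P/A`, and `l` and `e` are the logarithmic derivatives of `P/A` and of `E`. Testing this equation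
against `k` and against `v` shows that the second variation is negative if `e > 0` and `l ≤ 0`
(`linearized_form_neg`). The first is the hypothesis; the second must be proved
(`area_mul_deriv_le`).

To prove it, and to differentiate in `α` at all, the signed square root `s` of twice the potential
well is used as a coordinate. Energy levels become circles `s = -r cos θ`, `k' = r sin θ`, and with
`Y` the inverse coordinate the elapsed time is the nonsingular integral of `Y'(-r cos θ)`. The
period is nondecreasing in `r` because `Y''' ≥ 0`, which is Chicone's criterion (convexity of the
well divided by the squared force), here reduced to `well_ge`. The area is an explicit combination
of the period and the action `∫ (k')²`, whose `r`-derivative is `r` times the period; this turns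
monotonicity of the period into `l ≤ 0`. -/

theorem integral_eq_zero_of_hasDerivAt_periodic {F f : ℝ → ℝ} {X : ℝ}
    (hF : ∀ x, HasDerivAt F (f x) x) (hf : Continuous f) (hX : Function.Periodic F X) :
    ∫ x in (0 : ℝ)..X, f x = 0 := by
  rw [intervalIntegral.integral_eq_sub_of_hasDerivAt (fun x _ => hF x) (hf.intervalIntegrable _ _)]
  have := hX 0
  rw [zero_add] at this
  rw [this, sub_self]

theorem periodic_of_hasDerivAt {F f : ℝ → ℝ} {X : ℝ} (hF : ∀ x, HasDerivAt F (f x) x)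
    (hX : Function.Periodic F X) : Function.Periodic f X := by
  intro x
  have h1 : HasDerivAt (fun y => F (y + X)) (f (x + X)) x := (hF (x + X)).comp_add_const x X
  have h2 : (fun y => F (y + X)) = F := funext hX
  rw [h2] at h1
  exact h1.unique (hF x)

theorem exists_pos_bounds_of_periodic {f : ℝ → ℝ} {X : ℝ} (hX : 0 < X) (hf : Continuous f)
    (hp : Function.Periodic f X) (hpos : ∀ x, 0 < f x) :
    ∃ c C : ℝ, 0 < c ∧ ∀ x, f x ∈ Icc c C := by
  have hc := hp.compact_of_continuous hX.ne' hf
  obtain ⟨_, ⟨x, rfl⟩, hx⟩ := hc.exists_isLeast (range_nonempty f)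
  obtain ⟨_, ⟨y, rfl⟩, hy⟩ := hc.exists_isGreatest (range_nonempty f)
  exact ⟨f x, f y, hpos x, fun z => ⟨hx ⟨z, rfl⟩, hy ⟨z, rfl⟩⟩⟩

theorem exists_bound_of_periodic {f : ℝ → ℝ} {X : ℝ} (hX : 0 < X) (hf : Continuous f)
    (hp : Function.Periodic f X) : ∃ C : ℝ, ∀ x, |f x| ≤ C := by
  obtain ⟨c, C, -, h⟩ := exists_pos_bounds_of_periodic hX (f := fun x => |f x| + 1)
    (by fun_prop) (fun x => by simp only [hp x]) (fun x => by positivity)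
  exact ⟨C, fun x => by linarith [(h x).2]⟩

/-- The induction carries the regularity of `y` and `y1` together, since each step gains one
derivative of both. -/
theorem contDiff_of_bootstrap {y y1 y2 : ℝ → ℝ} (h1 : ∀ x, HasDerivAt y (y1 x) x)
    (h2 : ∀ x, HasDerivAt y1 (y2 x) x)
    (h : ∀ n : ℕ, ContDiff ℝ n y → ContDiff ℝ n y2) : ContDiff ℝ ∞ y := by
  have e1 : deriv y = y1 := funext fun x => (h1 x).deriv
  have e2 : deriv y1 = y2 := funext fun x => (h2 x).deriv
  rw [contDiff_infty]
  suffices H : ∀ n : ℕ, ContDiff ℝ n y ∧ ContDiff ℝ n y1 from fun n => (H n).1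
  intro n
  induction n with
  | zero =>
    exact ⟨contDiff_zero.2 (continuous_iff_continuousAt.2 fun x => (h1 x).continuousAt),
      contDiff_zero.2 (continuous_iff_continuousAt.2 fun x => (h2 x).continuousAt)⟩
  | succ n ih =>
    push_cast
    rw [contDiff_succ_iff_deriv, contDiff_succ_iff_deriv, e1, e2]
    exact ⟨⟨fun x => (h1 x).differentiableAt, by simp, ih.2⟩,
      ⟨fun x => (h2 x).differentiableAt, by simp, h n ih.1⟩⟩

/-! ### The canonical oscillator equation -/

/-- The restoring force of the canonical oscillator, `y ^ (q - 1)` being its derivative. -/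
def force (q y : ℝ) : ℝ := if q = 0 then Real.log y else (y ^ q - 1) / q

theorem hasDerivAt_force (q : ℝ) {y : ℝ} (hy : 0 < y) :
    HasDerivAt (force q) (y ^ (q - 1)) y := by
  by_cases hq : q = 0
  · subst hq
    have : force 0 = Real.log := by ext; simp [force]
    rw [this, zero_sub, Real.rpow_neg_one]
    exact Real.hasDerivAt_log hy.ne'
  · have : force q = fun y => (y ^ q - 1) / q := by ext; simp [force, hq]
    rw [this]
    have h := ((Real.hasDerivAt_rpow_const (p := q) (Or.inl hy.ne')).sub_const 1).div_const q
    rwa [mul_div_cancel_left₀ _ hq] at h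

theorem force_nonneg (q : ℝ) {y : ℝ} (hy : 1 ≤ y) : 0 ≤ force q y := by
  unfold force
  split_ifs with h
  · exact Real.log_nonneg hy
  · rcases lt_or_gt_of_ne h with h | h
    · exact div_nonneg_of_nonpos (by linarith [Real.rpow_le_one_of_one_le_of_nonpos hy h.le]) h.le
    · exact div_nonneg (by linarith [Real.one_le_rpow hy h.le]) h.le

theorem contDiffAt_force (q : ℝ) {y : ℝ} (hy : 0 < y) (n : WithTop ℕ∞) :
    ContDiffAt ℝ n (force q) y := by
  by_cases hq : q = 0
  · subst hq
    have : force 0 = Real.log := by ext; simp [force]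
    rw [this]
    exact Real.contDiffAt_log.2 hy.ne'
  · have : force q = fun y => (y ^ q - 1) / q := by ext; simp [force, hq]
    rw [this]
    exact ((Real.contDiffAt_rpow_const_of_ne hy.ne').sub contDiffAt_const).div_const q

theorem lipschitzOnWith_force (q : ℝ) {c C : ℝ} (hc : 0 < c) :
    ∃ L, LipschitzOnWith L (force q) (Icc c C) := by
  have hcont : ContinuousOn (fun y : ℝ => y ^ (q - 1)) (Icc c C) := fun y hy =>
    (Real.continuousAt_rpow_const _ _ (Or.inl (hc.trans_le hy.1).ne')).continuousWithinAt
  obtain ⟨M, hM⟩ := isCompact_Icc.exists_bound_of_continuousOn hcont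
  refine ⟨M.toNNReal, (convex_Icc c C).lipschitzOnWith_of_nnnorm_hasDerivWithin_le
    (fun y hy => (hasDerivAt_force q (hc.trans_le hy.1)).hasDerivWithinAt) fun y hy => ?_⟩
  rw [← NNReal.coe_le_coe, coe_nnnorm]
  exact (hM y hy).trans (Real.le_coe_toNNReal M)

theorem IsCanonicalSolution.hasDerivAt {q α : ℝ} {k : ℝ → ℝ} (hk : IsCanonicalSolution q α k)
    (x : ℝ) : HasDerivAt k (deriv k x) x :=
  (hk.smooth.differentiable (by simp) x).hasDerivAt

theorem IsCanonicalSolution.hasDerivAt_deriv {q α : ℝ} {k : ℝ → ℝ}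
    (hk : IsCanonicalSolution q α k) (x : ℝ) : HasDerivAt (deriv k) (-force q (k x)) x := by
  have h1 : ContDiff ℝ ∞ (deriv k) := by
    have := hk.smooth.iterate_deriv 1
    simpa using this
  have h2 := (h1.differentiable (by simp) x).hasDerivAt
  have h3 := hk.ode x
  rwa [show deriv (deriv k) x = -force q (k x) by unfold force; linarith] at h2

/-- The force need not be Lipschitz near zero, but positive periodic solutions stay in a compact
interval of `(0, ∞)`, where Picard-Lindelöf uniqueness for the first order system applies. -/
theorem IsCanonicalSolution.unique {q α : ℝ} {k l : ℝ → ℝ} (hk : IsCanonicalSolution q α k)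
    (hl : IsCanonicalSolution q α l) : k = l := by
  obtain ⟨p, hp, hkp⟩ := hk.periodic
  obtain ⟨r, hr, hlr⟩ := hl.periodic
  obtain ⟨c, C, hc, hkC⟩ := exists_pos_bounds_of_periodic hp hk.smooth.continuous hkp hk.pos
  obtain ⟨c', C', hc', hlC⟩ := exists_pos_bounds_of_periodic hr hl.smooth.continuous hlr hl.pos
  obtain ⟨L, hL⟩ := lipschitzOnWith_force q (C := max C C') (lt_min hc hc')
  set S : Set ℝ := Icc (min c c') (max C C')
  have hv : LipschitzOnWith (max 1 L) (fun z : ℝ × ℝ => (z.2, -force q z.1)) (S ×ˢ univ) := by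
    refine LipschitzOnWith.prodMk LipschitzWith.prod_snd.lipschitzOnWith ?_
    have h1 : LipschitzOnWith (L * 1) (fun z : ℝ × ℝ => force q z.1) (S ×ˢ univ) :=
      hL.comp LipschitzWith.prod_fst.lipschitzOnWith (fun z hz => hz.1)
    rw [mul_one] at h1
    exact h1.neg
  have key : (fun t => (k t, deriv k t)) = fun t => (l t, deriv l t) := by
    refine ODE_solution_unique_univ (v := fun _ z => (z.2, -force q z.1))
      (s := fun _ => S ×ˢ univ) (t₀ := 0) (fun _ => hv) (fun t => ⟨?_, ?_⟩) (fun t => ⟨?_, ?_⟩) ?_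
    · exact (hk.hasDerivAt t).prodMk (hk.hasDerivAt_deriv t)
    · exact ⟨⟨(min_le_left _ _).trans (hkC t).1, (hkC t).2.trans (le_max_left _ _)⟩, trivial⟩
    · exact (hl.hasDerivAt t).prodMk (hl.hasDerivAt_deriv t)
    · exact ⟨⟨(min_le_right _ _).trans (hlC t).1, (hlC t).2.trans (le_max_right _ _)⟩, trivial⟩
    · simp [hk.init, hl.init, hk.init_deriv, hl.init_deriv]
  funext t
  exact congrArg Prod.fst (congrFun key t)

theorem IsCanonicalSolution.kSol_eq {q α : ℝ} {k : ℝ → ℝ} (hk : IsCanonicalSolution q α k) :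
    kSol q α = k := by
  have h : ∃ k, IsCanonicalSolution q α k := ⟨k, hk⟩
  unfold kSol
  rw [dif_pos h]
  exact h.choose_spec.unique hk

/-- A nonzero value excludes the default zero function, so the existence of a solution need not be
known beforehand. -/
theorem isCanonicalSolution_kSol {q α x : ℝ} (h : kSol q α x ≠ 0) :
    IsCanonicalSolution q α (kSol q α) := by
  unfold kSol at h ⊢
  split_ifs at h ⊢ with hk
  · exact hk.choose_spec
  · exact absurd rfl h

/-! ### Steady states solve an oscillator equation -/

theorem exists_deriv2_add_force_eq_const {n m B X q : ℝ} (hX : 0 < X) (hq : q = m - n + 1)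
    {h : ℝ → ℝ} (hs : ContDiff ℝ 4 h) (hpos : ∀ x, 0 < h x) (hper : Function.Periodic h X)
    (hst : IsSteadyState (fun y => y ^ n) (fun y => B * y ^ m) h) :
    ∃ c : ℝ, ∀ x, HasDerivAt (deriv h) (c - B * force q (h x)) x := by
  have e2 : iteratedDeriv 2 h = deriv (deriv h) := by
    rw [iteratedDeriv_succ, iteratedDeriv_one]
  have e3 : iteratedDeriv 3 h = deriv (deriv (deriv h)) := by
    rw [iteratedDeriv_succ, e2]
  have d0 : ∀ x, HasDerivAt h (deriv h x) x := fun x =>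
    (hs.differentiable (by simp) x).hasDerivAt
  have d1 : ∀ x, HasDerivAt (deriv h) (deriv (deriv h) x) x := fun x => by
    have := hs.differentiable_iteratedDeriv 1 (by norm_num)
    rw [iteratedDeriv_one] at this
    exact (this x).hasDerivAt
  have d2 : ∀ x, HasDerivAt (deriv (deriv h)) (iteratedDeriv 3 h x) x := fun x => by
    have := hs.differentiable_iteratedDeriv 2 (by norm_num)
    rw [e2] at this
    rw [e3]
    exact (this x).hasDerivAt
  have d3 : Differentiable ℝ (iteratedDeriv 3 h) :=
    hs.differentiable_iteratedDeriv 3 (by norm_num)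
  have drpow : ∀ r : ℝ, Differentiable ℝ fun y => h y ^ r := fun r x =>
    ((d0 x).rpow_const (Or.inl (hpos x).ne')).differentiableAt
  have dF : Differentiable ℝ fun y => h y ^ n * iteratedDeriv 3 h y := (drpow n).mul d3
  have dG : Differentiable ℝ fun y => B * h y ^ m * deriv h y :=
    ((drpow m).const_mul B).mul fun x => (d1 x).differentiableAt
  have hconst : ∀ x y, h x ^ n * iteratedDeriv 3 h x + B * h x ^ m * deriv h x
      = h y ^ n * iteratedDeriv 3 h y + B * h y ^ m * deriv h y := by
    refine is_const_of_deriv_eq_zero (dF.add dG) fun x => ?_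
    have h1 := hst x
    have h2 := ((dF x).hasDerivAt.add (dG x).hasDerivAt).deriv
    simp only [] at h1
    exact h2.trans (by linarith)
  have hG : ∀ x, HasDerivAt (fun x => deriv (deriv h) x + B * force q (h x))
      (iteratedDeriv 3 h x + B * (h x ^ (q - 1) * deriv h x)) x := fun x =>
    (d2 x).add (((hasDerivAt_force q (hpos x)).comp x (d0 x)).const_mul B)
  have hGper : Function.Periodic (fun x => deriv (deriv h) x + B * force q (h x)) X := by
    intro x
    have := periodic_of_hasDerivAt d1 (periodic_of_hasDerivAt d0 hper)
    simp only [this x, hper x]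
  have hmul : ∀ x, h x ^ n * iteratedDeriv 3 h x + B * h x ^ m * deriv h x =
      h x ^ n * (iteratedDeriv 3 h x + B * (h x ^ (q - 1) * deriv h x)) := fun x => by
    have : h x ^ m = h x ^ n * h x ^ (q - 1) := by
      rw [← Real.rpow_add (hpos x), hq]; congr 1; ring
    rw [this]; ring
  -- Rolle's theorem over one period gives a point of zero flux, and the flux is constant.
  obtain ⟨ξ, -, hξ⟩ := exists_hasDerivAt_eq_zero hX
    (fun x _ => (hG x).continuousAt.continuousWithinAt)
    (by simpa using (hGper 0).symm) (fun x _ => hG x)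
  have hzero : ∀ x, iteratedDeriv 3 h x + B * (h x ^ (q - 1) * deriv h x) = 0 := fun x => by
    have h1 := hconst x ξ
    rw [hmul, hmul, hξ, mul_zero] at h1
    exact (mul_eq_zero.1 h1).resolve_left (Real.rpow_pos_of_pos (hpos x) n).ne'
  have hc := is_const_of_deriv_eq_zero (fun x => (hG x).differentiableAt)
    (fun x => (hG x).deriv.trans (hzero x))
  refine ⟨deriv (deriv h) 0 + B * force q (h 0), fun x => ?_⟩
  have h1 := hc 0 x
  rw [h1, add_sub_cancel_right]
  exact d1 x

/-- The nonlinearity of the oscillator equation with constants `B` and `D`. -/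
def osc (q B D y : ℝ) : ℝ := if q = 0 then B * Real.log y - D else (B * y ^ q - D) / q

theorem osc_eq (q B D y : ℝ) :
    osc q B D y = B * force q y - (if q = 0 then D else (D - B) / q) := by
  unfold osc force
  split_ifs <;> ring

theorem exists_osc {q B X c : ℝ} (hB : 0 < B) (hX : 0 < X) {h : ℝ → ℝ}
    (hd : ∀ x, HasDerivAt h (deriv h x) x) (hpos : ∀ x, 0 < h x) (hper : Function.Periodic h X)
    (hc : ∀ x, HasDerivAt (deriv h) (c - B * force q (h x)) x) :
    ∃ D : ℝ, (q ≠ 0 → 0 < D) ∧ ∀ x, HasDerivAt (deriv h) (-osc q B D (h x)) x := by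
  by_cases hq : q = 0
  · refine ⟨c, fun h => absurd hq h, fun x => ?_⟩
    rw [osc_eq, if_pos hq, neg_sub]
    exact hc x
  · refine ⟨q * c + B, fun _ => ?_, fun x => ?_⟩
    · have hp := periodic_of_hasDerivAt hd hper
      obtain ⟨ξ, -, hξ⟩ := exists_hasDerivAt_eq_zero hX
        (fun x _ => (hc x).continuousAt.continuousWithinAt)
        (by simpa using (hp 0).symm) (fun x _ => hc x)
      -- `D` is positive because at a critical point of `h'` it equals `B h^q`.
      have h1 : q * c + B = B * h ξ ^ q := by
        have : c = B * force q (h ξ) := by linarith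
        rw [this]
        unfold force
        rw [if_neg hq]
        field_simp
        ring
      rw [h1]
      exact mul_pos hB (Real.rpow_pos_of_pos (hpos ξ) q)
    · rw [osc_eq, if_neg hq, neg_sub, add_sub_cancel_right, mul_div_cancel_left₀ _ hq]
      exact hc x

theorem contDiff_of_hasDerivAt_force {q B c : ℝ} {h h1 : ℝ → ℝ} (hpos : ∀ x, 0 < h x)
    (hd : ∀ x, HasDerivAt h (h1 x) x)
    (hc : ∀ x, HasDerivAt h1 (c - B * force q (h x)) x) : ContDiff ℝ ∞ h := by
  refine contDiff_of_bootstrap hd hc fun n hn => ?_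
  refine contDiff_const.sub (contDiff_const.mul ?_)
  exact contDiff_iff_contDiffAt.2 fun x => (contDiffAt_force q (hpos x) n).comp x hn.contDiffAt

/-! ### Rescaling to the canonical solution -/

/-- This hides the case distinction at `q = 0`: afterwards only the amplitude factor `b`, the length
factor `c` and two relations between them matter. The relation `b c² B = b^q` is what transports the
quadratic form of the second variation. -/
theorem exists_rescale_eq (q : ℝ) {B D : ℝ} (hB : 0 < B) (hD : q ≠ 0 → 0 < D) :
    ∃ b c : ℝ, 0 < b ∧ 0 < c ∧ (∀ h x, rescale q B D h x = b * h (c * x)) ∧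
      b * c ^ 2 * B = b ^ q ∧ ∀ y, 0 < y → b * c ^ 2 * osc q B D y = force q (b * y) := by
  by_cases hq : q = 0
  · have hc2 : (Real.exp (D / (2 * B)) / B ^ (1 / 2 : ℝ)) ^ 2 = Real.exp (D / B) / B := by
      rw [div_pow, ← Real.sqrt_eq_rpow, Real.sq_sqrt hB.le, ← Real.exp_nat_mul]
      congr 2
      push_cast
      field_simp
    have hbc : Real.exp (-D / B) * (Real.exp (D / (2 * B)) / B ^ (1 / 2 : ℝ)) ^ 2 = B⁻¹ := by
      rw [hc2, ← mul_div_assoc, ← Real.exp_add, neg_div, neg_add_cancel, Real.exp_zero, one_div]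
    refine ⟨Real.exp (-D / B), Real.exp (D / (2 * B)) / B ^ (1 / 2 : ℝ), by positivity,
      by positivity, fun h x => ?_, ?_, fun y hy => ?_⟩
    · simp only [rescale, hq, if_true]
      congr 2
      ring
    · rw [hbc, hq, Real.rpow_zero, inv_mul_cancel₀ hB.ne']
    · rw [hbc, osc, force, if_pos hq, if_pos hq, Real.log_mul (Real.exp_pos _).ne' hy.ne',
        Real.log_exp]
      field_simp
      ring
  · have hD := hD hq
    have hBD : 0 < B / D := div_pos hB hD
    have hDB : 0 < D / B := div_pos hD hB
    have hc2 : ((D / B) ^ (1 / (2 * q)) / D ^ (1 / 2 : ℝ)) ^ 2 = (D / B) ^ (1 / q) / D := by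
      rw [div_pow, ← Real.sqrt_eq_rpow, Real.sq_sqrt hD.le, ← Real.rpow_mul_natCast hDB.le]
      congr 2
      push_cast
      field_simp
    have hbc : (B / D) ^ (1 / q) * ((D / B) ^ (1 / (2 * q)) / D ^ (1 / 2 : ℝ)) ^ 2 = D⁻¹ := by
      rw [hc2, ← mul_div_assoc, ← Real.mul_rpow hBD.le hDB.le]
      have : B / D * (D / B) = 1 := by field_simp
      rw [this, Real.one_rpow, one_div]
    have hbq : ((B / D) ^ (1 / q)) ^ q = B / D := by
      rw [← Real.rpow_mul hBD.le, one_div_mul_cancel hq, Real.rpow_one]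
    refine ⟨(B / D) ^ (1 / q), (D / B) ^ (1 / (2 * q)) / D ^ (1 / 2 : ℝ), by positivity,
      by positivity, fun h x => ?_, ?_, fun y hy => ?_⟩
    · simp only [rescale, hq, if_false]
      congr 2
      ring
    · rw [hbc, hbq]
      field_simp
    · rw [hbc, osc, force, if_neg hq, if_neg hq, Real.mul_rpow (by positivity) hy.le, hbq]
      field_simp

theorem rescale_isCanonicalSolution {q B D X : ℝ} (hB : 0 < B) (hX : 0 < X)
    (hD : q ≠ 0 → 0 < D) {h : ℝ → ℝ} (hpos : ∀ x, 0 < h x) (hper : Function.Periodic h X)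
    (hd : ∀ x, HasDerivAt h (deriv h x) x)
    (hosc : ∀ x, HasDerivAt (deriv h) (-osc q B D (h x)) x) (h0 : deriv h 0 = 0) :
    IsCanonicalSolution q (rescale q B D h 0) (rescale q B D h) := by
  obtain ⟨b, c, hb, hc, hbc, -, hforce⟩ := exists_rescale_eq q hB hD
  have e : rescale q B D h = fun x => b * h (c * x) := funext (hbc h)
  rw [e]
  have hmulc : ∀ x, HasDerivAt (fun x => c * x) c x := fun x => by
    simpa using (hasDerivAt_id x).const_mul c
  have d1 : ∀ x, HasDerivAt (fun x => b * h (c * x)) (b * (deriv h (c * x) * c)) x := fun x =>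
    ((hd (c * x)).comp x (hmulc x)).const_mul b
  have d2 : ∀ x, HasDerivAt (fun x => b * (deriv h (c * x) * c))
      (0 - 1 * force q (b * h (c * x))) x := fun x => by
    have := ((((hosc (c * x)).comp x (hmulc x))).mul_const c).const_mul b
    refine this.congr_deriv ?_
    rw [← hforce _ (hpos _)]
    ring
  have e1 : deriv (fun x => b * h (c * x)) = fun x => b * (deriv h (c * x) * c) :=
    funext fun x => (d1 x).deriv
  refine ⟨contDiff_of_hasDerivAt_force (fun x => mul_pos hb (hpos _)) d1 d2,
    fun x => mul_pos hb (hpos _), ⟨X / c, div_pos hX hc, fun x => ?_⟩, fun x => ?_, rfl, ?_⟩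
  · simp only []
    rw [mul_add, mul_div_cancel₀ _ hc.ne', hper]
  · rw [e1, (d2 x).deriv]
    unfold force
    ring
  · rw [e1]
    simp [h0]

/-- If the minimum were at least `1`, the force would be nonnegative along `k`, so `k'` would be
both monotone and periodic, hence constant and equal to `k'(0) = 0`. -/
theorem IsCanonicalSolution.lt_one {q α : ℝ} {k : ℝ → ℝ} (hk : IsCanonicalSolution q α k)
    (hmin : ∀ x, k 0 ≤ k x) (hne : ¬ ∃ c : ℝ, ∀ x, k x = c) : α < 1 := by
  by_contra! hα
  obtain ⟨p, hp, hper⟩ := hk.periodic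
  have hanti : Antitone (deriv k) := by
    refine antitone_of_deriv_nonpos (fun x => (hk.hasDerivAt_deriv x).differentiableAt) fun x => ?_
    rw [(hk.hasDerivAt_deriv x).deriv, neg_nonpos]
    exact force_nonneg q (hα.trans (hk.init ▸ hmin x))
  have hper' := periodic_of_hasDerivAt hk.hasDerivAt hper
  have hzero : ∀ x, deriv k x = 0 := fun x => by
    obtain ⟨i, hi⟩ := Archimedean.arch x hp
    obtain ⟨j, hj⟩ := Archimedean.arch (-x) hp
    have h1 : deriv k (i • p) = 0 := by
      rw [(hper'.nsmul i).eq, hk.init_deriv]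
    have h2 : deriv k (-(j • p)) = 0 := by
      rw [(hper'.nsmul j).neg_eq, hk.init_deriv]
    have h3 := hanti hi
    have h4 := hanti (show -(j • p) ≤ x by linarith)
    linarith
  exact hne ⟨k 0, fun x => is_const_of_deriv_eq_zero
    (fun x => (hk.hasDerivAt x).differentiableAt) hzero x 0⟩

theorem existsUnique_rescalesTo {q B D X : ℝ} (hB : 0 < B) (hX : 0 < X)
    (hD : q ≠ 0 → 0 < D) {h : ℝ → ℝ} (hpos : ∀ x, 0 < h x) (hper : Function.Periodic h X)
    (hne : ¬ ∃ c : ℝ, ∀ x, h x = c) (hd : ∀ x, HasDerivAt h (deriv h x) x)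
    (hosc : ∀ x, HasDerivAt (deriv h) (-osc q B D (h x)) x) (hmin : ∀ x, h 0 ≤ h x) :
    ∃! α : ℝ, α ∈ Ioo (0 : ℝ) 1 ∧ RescalesTo q B h α := by
  have h0 : deriv h 0 = 0 := IsLocalMin.deriv_eq_zero (Filter.Eventually.of_forall hmin)
  have hk := rescale_isCanonicalSolution hB hX hD hpos hper hd hosc h0
  obtain ⟨b, c, hb, hc, hbc, -, -⟩ := exists_rescale_eq q hB hD
  refine ⟨rescale q B D h 0, ⟨⟨hk.pos 0, hk.lt_one (fun x => ?_) ?_⟩, D, hD, fun x => ?_,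
    fun x => ?_⟩, ?_⟩
  · rw [hbc, hbc, mul_zero]
    exact mul_le_mul_of_nonneg_left (hmin _) hb.le
  · rintro ⟨C, hC⟩
    refine hne ⟨C / b, fun x => ?_⟩
    have := hC (x / c)
    rw [hbc, mul_div_cancel₀ _ hc.ne'] at this
    rw [← this, mul_div_cancel_left₀ _ hb.ne']
  · rw [(hosc x).deriv]
    exact neg_add_cancel (osc q B D (h x))
  · rw [hk.kSol_eq]
  · rintro α ⟨hα, D', hD', hosc', hk'⟩
    -- The oscillator equation at a single point determines its constant.
    have hDD : D' = D := by
      have h1 : deriv (deriv h) 0 + osc q B D' (h 0) = 0 := hosc' 0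
      rw [(hosc 0).deriv] at h1
      unfold osc at h1
      split_ifs at h1 with hq
      · linarith
      · field_simp at h1
        linarith
    subst hDD
    have h1 := hk' 0
    have h2 : kSol q α 0 ≠ 0 := by rw [← h1]; exact (hk.pos 0).ne'
    rw [h1, (isCanonicalSolution_kSol h2).init]

/-! ### Expansion of the energy -/

theorem abs_sub_le_of_abs_deriv_le {g g' : ℝ → ℝ} {M : ℝ}
    (hg : ∀ t ∈ Icc (0 : ℝ) 1, HasDerivAt g (g' t) t) (hM : ∀ t ∈ Icc (0 : ℝ) 1, |g' t| ≤ M) :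
    ∀ t ∈ Icc (0 : ℝ) 1, |g t - g 0| ≤ M := by
  intro t ht
  have hM0 : 0 ≤ M := (abs_nonneg _).trans (hM t ht)
  have h := (convex_Icc (0 : ℝ) 1).norm_image_sub_le_of_norm_hasDerivWithin_le
    (fun x hx => (hg x hx).hasDerivWithinAt) hM (left_mem_Icc.2 zero_le_one) ht
  rw [sub_zero, Real.norm_eq_abs, Real.norm_eq_abs, abs_of_nonneg ht.1] at h
  exact h.trans (mul_le_of_le_one_right hM0 ht.2)

/-- The mean value inequality is applied five times, each time to a derivative minus its Taylor
polynomial. The factor `1/120` is lost, which is harmless. -/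
theorem abs_taylor_four_le {f0 f1 f2 f3 f4 f5 : ℝ → ℝ} {M : ℝ}
    (h0 : ∀ t ∈ Icc (0 : ℝ) 1, HasDerivAt f0 (f1 t) t)
    (h1 : ∀ t ∈ Icc (0 : ℝ) 1, HasDerivAt f1 (f2 t) t)
    (h2 : ∀ t ∈ Icc (0 : ℝ) 1, HasDerivAt f2 (f3 t) t)
    (h3 : ∀ t ∈ Icc (0 : ℝ) 1, HasDerivAt f3 (f4 t) t)
    (h4 : ∀ t ∈ Icc (0 : ℝ) 1, HasDerivAt f4 (f5 t) t)
    (hM : ∀ t ∈ Icc (0 : ℝ) 1, |f5 t| ≤ M) :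
    |f0 1 - (f0 0 + f1 0 + f2 0 / 2 + f3 0 / 6 + f4 0 / 24)| ≤ M := by
  have p1 : ∀ (c t : ℝ), HasDerivAt (fun s : ℝ => c * s) c t := fun c t => by
    simpa using (hasDerivAt_id t).const_mul c
  have p2 : ∀ (c t : ℝ), HasDerivAt (fun s : ℝ => c * s ^ 2 / 2) (c * t) t := fun c t => by
    refine (((hasDerivAt_pow 2 t).const_mul c).div_const 2).congr_deriv ?_
    norm_num; ring
  have p3 : ∀ (c t : ℝ), HasDerivAt (fun s : ℝ => c * s ^ 3 / 6) (c * t ^ 2 / 2) t := fun c t => by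
    refine (((hasDerivAt_pow 3 t).const_mul c).div_const 6).congr_deriv ?_
    norm_num; ring
  have p4 : ∀ (c t : ℝ), HasDerivAt (fun s : ℝ => c * s ^ 4 / 24) (c * t ^ 3 / 6) t := fun c t => by
    refine (((hasDerivAt_pow 4 t).const_mul c).div_const 24).congr_deriv ?_
    norm_num; ring
  have b4 := abs_sub_le_of_abs_deriv_le h4 hM
  have b3 := abs_sub_le_of_abs_deriv_le (g := fun t => f3 t - f4 0 * t)
    (fun t ht => (h3 t ht).sub (p1 _ t)) b4
  have b2 := abs_sub_le_of_abs_deriv_le (g := fun t => f2 t - f4 0 * t ^ 2 / 2 - f3 0 * t)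
    (fun t ht => ((h2 t ht).sub (p2 _ t)).sub (p1 _ t)) (M := M) fun t ht => by
      have := b3 t ht
      simp only [mul_zero, sub_zero] at this
      convert this using 2
  have b1 := abs_sub_le_of_abs_deriv_le
    (g := fun t => f1 t - f4 0 * t ^ 3 / 6 - f3 0 * t ^ 2 / 2 - f2 0 * t)
    (fun t ht => (((h1 t ht).sub (p3 _ t)).sub (p2 _ t)).sub (p1 _ t)) (M := M) fun t ht => by
      have := b2 t ht
      simp only [mul_zero, sub_zero, ne_eq, OfNat.ofNat_ne_zero, not_false_eq_true, zero_pow,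
        zero_div] at this
      convert this using 2
  have b0 := abs_sub_le_of_abs_deriv_le
    (g := fun t => f0 t - f4 0 * t ^ 4 / 24 - f3 0 * t ^ 3 / 6 - f2 0 * t ^ 2 / 2 - f1 0 * t)
    (fun t ht => ((((h0 t ht).sub (p4 _ t)).sub (p3 _ t)).sub (p2 _ t)).sub (p1 _ t)) (M := M)
    fun t ht => by
      have := b1 t ht
      simp only [mul_zero, sub_zero, ne_eq, OfNat.ofNat_ne_zero, not_false_eq_true, zero_pow,
        zero_div] at this
      convert this using 2
  have := b0 1 (right_mem_Icc.2 zero_le_one)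
  simp only [mul_zero, sub_zero, ne_eq, OfNat.ofNat_ne_zero, not_false_eq_true, zero_pow,
    zero_div, one_pow, mul_one] at this
  convert this using 2
  ring

theorem hasDerivAt_rpow_of_eq {r s y : ℝ} (hy : 0 < y) (hs : s = r - 1) :
    HasDerivAt (fun z : ℝ => z ^ r) (r * y ^ s) y := by
  rw [hs]
  exact Real.hasDerivAt_rpow_const (Or.inl hy.ne')

theorem IsPotential.hasDerivAt_deriv {n m B q : ℝ} {H : ℝ → ℝ} (hq : q = m - n + 1)
    (hH : IsPotential (fun y => y ^ n) (fun y => B * y ^ m) H) {y : ℝ} (hy : 0 < y) :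
    HasDerivAt (deriv H) (B * y ^ (q - 1)) y := by
  refine (hH y hy).2.congr_deriv ?_
  simp only []
  rw [mul_div_assoc, ← Real.rpow_sub hy, hq, add_sub_cancel_right]

/-- Only two derivatives of `H` are assumed, but the second is an explicit power, so three more
exist and the fifth is bounded on a compact interval of `(0, ∞)`. The remainder is therefore uniform
in the base point. -/
theorem IsPotential.exists_taylor_bound {n m B q : ℝ} {H : ℝ → ℝ} (hq : q = m - n + 1)
    (hH : IsPotential (fun y => y ^ n) (fun y => B * y ^ m) H) {c C : ℝ} (hc : 0 < c) :
    ∃ M : ℝ, ∀ y δ : ℝ, y ∈ Icc c C → y + δ ∈ Icc c C →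
      |H (y + δ) - (H y + δ * deriv H y + δ ^ 2 * (B * y ^ (q - 1)) / 2
        + δ ^ 3 * (B * ((q - 1) * y ^ (q - 2))) / 6
        + δ ^ 4 * (B * ((q - 1) * ((q - 2) * y ^ (q - 3)))) / 24)| ≤ |δ| ^ 5 * M := by
  have hcont : ContinuousOn (fun y : ℝ => B * ((q - 1) * ((q - 2) * ((q - 3) * y ^ (q - 4)))))
      (Icc c C) := fun y hy => by
    have := (Real.continuousAt_rpow_const y (q - 4) (Or.inl (hc.trans_le hy.1).ne'))
    exact (continuousAt_const.mul (continuousAt_const.mul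
      (continuousAt_const.mul (continuousAt_const.mul this)))).continuousWithinAt
  obtain ⟨M, hM⟩ := isCompact_Icc.exists_bound_of_continuousOn hcont
  refine ⟨M, fun y δ hy hyδ => ?_⟩
  have hmem : ∀ t ∈ Icc (0 : ℝ) 1, y + t * δ ∈ Icc c C := fun t ht => by
    have := (convex_Icc c C) hy hyδ (sub_nonneg.2 ht.2) ht.1 (by ring)
    convert this using 1
    simp only [smul_eq_mul]; ring
  have hpos : ∀ t ∈ Icc (0 : ℝ) 1, 0 < y + t * δ := fun t ht => hc.trans_le (hmem t ht).1
  have hl : ∀ t : ℝ, HasDerivAt (fun t => y + t * δ) δ t := fun t => by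
    simpa using ((hasDerivAt_id t).mul_const δ).const_add y
  have key := abs_taylor_four_le (M := |δ| ^ 5 * M)
    (f0 := fun t => H (y + t * δ)) (f1 := fun t => δ * deriv H (y + t * δ))
    (f2 := fun t => δ ^ 2 * (B * (y + t * δ) ^ (q - 1)))
    (f3 := fun t => δ ^ 3 * (B * ((q - 1) * (y + t * δ) ^ (q - 2))))
    (f4 := fun t => δ ^ 4 * (B * ((q - 1) * ((q - 2) * (y + t * δ) ^ (q - 3)))))
    (f5 := fun t => δ ^ 5 * (B * ((q - 1) * ((q - 2) * ((q - 3) * (y + t * δ) ^ (q - 4))))))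
    ?_ ?_ ?_ ?_ ?_ ?_
  · simpa using key
  · intro t ht
    exact ((hH _ (hpos t ht)).1.hasDerivAt.comp t (hl t)).congr_deriv (mul_comm _ _)
  · intro t ht
    refine (((hH.hasDerivAt_deriv hq (hpos t ht)).comp t (hl t)).const_mul δ).congr_deriv ?_
    ring
  · intro t ht
    refine ((((hasDerivAt_rpow_of_eq (s := q - 2) (hpos t ht) (by ring)).comp t
      (hl t)).const_mul B).const_mul (δ ^ 2)).congr_deriv ?_
    ring
  · intro t ht
    refine (((((hasDerivAt_rpow_of_eq (s := q - 3) (hpos t ht) (by ring)).comp t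
      (hl t)).const_mul (q - 1)).const_mul B).const_mul (δ ^ 3)).congr_deriv ?_
    ring
  · intro t ht
    refine ((((((hasDerivAt_rpow_of_eq (s := q - 4) (hpos t ht) (by ring)).comp t
      (hl t)).const_mul (q - 2)).const_mul (q - 1)).const_mul B).const_mul (δ ^ 4)).congr_deriv ?_
    ring
  · intro t ht
    rw [abs_mul, abs_pow]
    exact mul_le_mul_of_nonneg_left (hM _ (hmem t ht)) (by positivity)

/-- A positive `X`-periodic solution `h`, with derivatives `h1` and `h2`, of the differentiated
oscillator equation `h''' + B h^(q-1) h' = 0`. -/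
structure IsOscillation (q B X : ℝ) (h h1 h2 : ℝ → ℝ) : Prop where
  pos : ∀ x, 0 < h x
  periodic : Function.Periodic h X
  deriv0 : ∀ x, HasDerivAt h (h1 x) x
  deriv1 : ∀ x, HasDerivAt h1 (h2 x) x
  deriv2 : ∀ x, HasDerivAt h2 (-(B * h x ^ (q - 1) * h1 x)) x

namespace IsOscillation

variable {q B X : ℝ} {h h1 h2 : ℝ → ℝ}

theorem continuous0 (o : IsOscillation q B X h h1 h2) : Continuous h :=
  continuous_iff_continuousAt.2 fun x => (o.deriv0 x).continuousAt

theorem continuous1 (o : IsOscillation q B X h h1 h2) : Continuous h1 :=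
  continuous_iff_continuousAt.2 fun x => (o.deriv1 x).continuousAt

theorem continuous2 (o : IsOscillation q B X h h1 h2) : Continuous h2 :=
  continuous_iff_continuousAt.2 fun x => (o.deriv2 x).continuousAt

theorem continuous_rpow (o : IsOscillation q B X h h1 h2) (r : ℝ) :
    Continuous fun x => h x ^ r :=
  o.continuous0.rpow_const fun x => Or.inl (o.pos x).ne'

theorem hasDerivAt_rpow (o : IsOscillation q B X h h1 h2) {r s : ℝ} (hs : s = r - 1) (x : ℝ) :
    HasDerivAt (fun x => h x ^ r) (r * h x ^ s * h1 x) x :=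
  (hasDerivAt_rpow_of_eq (o.pos x) hs).comp x (o.deriv0 x)

theorem periodic1 (o : IsOscillation q B X h h1 h2) : Function.Periodic h1 X :=
  periodic_of_hasDerivAt o.deriv0 o.periodic

theorem periodic2 (o : IsOscillation q B X h h1 h2) : Function.Periodic h2 X :=
  periodic_of_hasDerivAt o.deriv1 o.periodic1

/-- After integration by parts the integrand is a constant times `u`, because `h'' + H'(h)` has zero
derivative. -/
theorem first_variation {n m : ℝ} {H u u1 : ℝ → ℝ} (hq : q = m - n + 1)
    (hH : IsPotential (fun y => y ^ n) (fun y => B * y ^ m) H)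
    (o : IsOscillation q B X h h1 h2) (hu : ∀ x, HasDerivAt u (u1 x) x) (hu1 : Continuous u1)
    (hper : Function.Periodic u X) (hmean : ∫ x in (0 : ℝ)..X, u x = 0) :
    ∫ x in (0 : ℝ)..X, (h1 x * u1 x - deriv H (h x) * u x) = 0 := by
  have hd : ∀ x, HasDerivAt (fun x => h2 x + deriv H (h x)) 0 x := fun x => by
    refine ((o.deriv2 x).add
      ((hH.hasDerivAt_deriv hq (o.pos x)).comp x (o.deriv0 x))).congr_deriv ?_
    ring
  have hconst : ∀ x, h2 x + deriv H (h x) = h2 0 + deriv H (h 0) := fun x =>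
    is_const_of_deriv_eq_zero (fun x => (hd x).differentiableAt) (fun x => (hd x).deriv) x 0
  have huc : Continuous u := continuous_iff_continuousAt.2 fun x => (hu x).continuousAt
  have hF : ∀ x, HasDerivAt (fun x => h1 x * u x) (h2 x * u x + h1 x * u1 x) x := fun x =>
    (o.deriv1 x).mul (hu x)
  have c1 := o.continuous1
  have c2 := o.continuous2
  have hF0 := integral_eq_zero_of_hasDerivAt_periodic (X := X) hF (by fun_prop) fun x => by
    simp only [o.periodic1 x, hper x]
  have e : ∀ x, h1 x * u1 x - deriv H (h x) * u x =
      (h2 x * u x + h1 x * u1 x) - (h2 0 + deriv H (h 0)) * u x := fun x => by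
    rw [← hconst x]; ring
  simp only [e]
  rw [intervalIntegral.integral_sub (Continuous.intervalIntegrable (by fun_prop) _ _)
    (Continuous.intervalIntegrable (by fun_prop) _ _), hF0, intervalIntegral.integral_const_mul,
    hmean, mul_zero, sub_zero]

theorem exists_energy_le {n m : ℝ} {H u u1 : ℝ → ℝ} (hq : q = m - n + 1) (hX : 0 < X)
    (hH : IsPotential (fun y => y ^ n) (fun y => B * y ^ m) H)
    (o : IsOscillation q B X h h1 h2) (hu : ∀ x, HasDerivAt u (u1 x) x) (hu1 : Continuous u1)
    (hper : Function.Periodic u X) (hmean : ∫ x in (0 : ℝ)..X, u x = 0) :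
    ∃ R : ℝ, ∀ᶠ ε in 𝓝[>] (0 : ℝ), energy H X (fun x => h x + ε * u x) ≤ energy H X h
      + ε ^ 2 / 2 * (∫ x in (0 : ℝ)..X, (u1 x ^ 2 - B * h x ^ (q - 1) * u x ^ 2))
      - ε ^ 3 / 6 * (∫ x in (0 : ℝ)..X, B * ((q - 1) * h x ^ (q - 2)) * u x ^ 3)
      - ε ^ 4 / 24 * (∫ x in (0 : ℝ)..X, B * ((q - 1) * ((q - 2) * h x ^ (q - 3))) * u x ^ 4)
      + ε ^ 5 * R := by
  have huc : Continuous u := continuous_iff_continuousAt.2 fun x => (hu x).continuousAt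
  obtain ⟨c, C, hc, hcC⟩ := exists_pos_bounds_of_periodic hX o.continuous0 o.periodic o.pos
  obtain ⟨U, hU⟩ := exists_bound_of_periodic hX huc hper
  have hU0 : 0 ≤ U := (abs_nonneg _).trans (hU 0)
  obtain ⟨M, hM⟩ := hH.exists_taylor_bound hq (c := c / 2) (C := C + c / 2) (half_pos hc)
  have hM0 : 0 ≤ M := by
    have hcC0 := hcC 0
    have := hM (h 0) (c / 2) ⟨by linarith [hcC0.1], by linarith [hcC0.2]⟩
      ⟨by linarith [hcC0.1], by linarith [hcC0.2]⟩
    have h5 : 0 < |c / 2| ^ 5 := by positivity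
    exact nonneg_of_mul_nonneg_right ((abs_nonneg _).trans this) h5
  refine ⟨U ^ 5 * M * X, ?_⟩
  -- This threshold keeps `|ε u| ≤ c / 2`, so the perturbed profile stays in the interval of the
  -- Taylor bound; `U + 1` avoids a zero denominator.
  have hε1 : ∀ᶠ ε in 𝓝[>] (0 : ℝ), ε < c / 2 / (U + 1) :=
    nhdsWithin_le_nhds (gt_mem_nhds (by positivity))
  filter_upwards [hε1, self_mem_nhdsWithin] with ε hε hε0
  have hε0 : 0 < ε := hε0
  have hδ : ∀ x, |ε * u x| ≤ c / 2 := fun x => by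
    rw [abs_mul, abs_of_pos hε0]
    rw [lt_div_iff₀ (by positivity)] at hε
    nlinarith [hU x]
  have hm1 : ∀ x, h x ∈ Icc (c / 2) (C + c / 2) := fun x =>
    ⟨by linarith [(hcC x).1], by linarith [(hcC x).2]⟩
  have hm2 : ∀ x, h x + ε * u x ∈ Icc (c / 2) (C + c / 2) := fun x =>
    ⟨by linarith [(hcC x).1, (abs_le.1 (hδ x)).1], by linarith [(hcC x).2, (abs_le.1 (hδ x)).2]⟩
  have cH : ∀ g : ℝ → ℝ, Continuous g → (∀ x, 0 < g x) → Continuous fun x => H (g x) :=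
    fun g hg hg0 => continuous_iff_continuousAt.2 fun x =>
      ContinuousAt.comp (f := g) (hH _ (hg0 x)).1.continuousAt hg.continuousAt
  have cH' : Continuous fun x => deriv H (h x) := continuous_iff_continuousAt.2 fun x =>
    ContinuousAt.comp (f := h) (hH _ (o.pos x)).2.continuousAt o.continuous0.continuousAt
  have c0 := o.continuous0
  have c1 := o.continuous1
  have r1 := o.continuous_rpow (q - 1)
  have r2 := o.continuous_rpow (q - 2)
  have r3 := o.continuous_rpow (q - 3)
  have cHh := cH h c0 o.pos
  have cHe := cH (fun x => h x + ε * u x) (by fun_prop) fun x => (half_pos hc).trans_le (hm2 x).1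
  clear cH
  set rem : ℝ → ℝ := fun x => H (h x + ε * u x) - (H (h x) + (ε * u x) * deriv H (h x)
    + (ε * u x) ^ 2 * (B * h x ^ (q - 1)) / 2
    + (ε * u x) ^ 3 * (B * ((q - 1) * h x ^ (q - 2))) / 6
    + (ε * u x) ^ 4 * (B * ((q - 1) * ((q - 2) * h x ^ (q - 3)))) / 24) with hrem
  have crem : Continuous rem := by
    rw [hrem]
    refine cHe.sub (Continuous.add (Continuous.add (Continuous.add (Continuous.add cHh ?_) ?_)
      ?_) ?_) <;> fun_prop
  have hremle : ∀ x, |rem x| ≤ ε ^ 5 * U ^ 5 * M := fun x => by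
    refine (hM _ _ (hm1 x) (hm2 x)).trans (mul_le_mul_of_nonneg_right ?_ hM0)
    rw [abs_mul, abs_of_pos hε0, mul_pow]
    gcongr
    exact hU x
  have hremint : |∫ x in (0 : ℝ)..X, rem x| ≤ ε ^ 5 * U ^ 5 * M * X := by
    have := intervalIntegral.norm_integral_le_of_norm_le_const (a := 0) (b := X) (f := rem)
      (C := ε ^ 5 * U ^ 5 * M) fun x _ => hremle x
    rwa [sub_zero, abs_of_pos hX, Real.norm_eq_abs] at this
  have hfv := o.first_variation hq hH hu hu1 hper hmean
  have e0 : energy H X h = ∫ x in (0 : ℝ)..X, ((1 / 2) * h1 x ^ 2 - H (h x)) := by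
    unfold energy
    simp only [fun x => (o.deriv0 x).deriv]
  have e1 : energy H X (fun x => h x + ε * u x) = ∫ x in (0 : ℝ)..X,
      (((1 / 2) * h1 x ^ 2 - H (h x)) + ε * (h1 x * u1 x - deriv H (h x) * u x)
        + ε ^ 2 / 2 * (u1 x ^ 2 - B * h x ^ (q - 1) * u x ^ 2)
        - ε ^ 3 / 6 * (B * ((q - 1) * h x ^ (q - 2)) * u x ^ 3)
        - ε ^ 4 / 24 * (B * ((q - 1) * ((q - 2) * h x ^ (q - 3))) * u x ^ 4)
        - rem x) := by
    unfold energy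
    refine intervalIntegral.integral_congr fun x _ => ?_
    have hd : deriv (fun x => h x + ε * u x) x = h1 x + ε * u1 x :=
      ((o.deriv0 x).add ((hu x).const_mul ε)).deriv
    simp only []
    rw [hd, hrem]
    ring
  have ii : ∀ {f : ℝ → ℝ}, Continuous f → IntervalIntegrable f MeasureTheory.volume 0 X :=
    fun hf => hf.intervalIntegrable _ _
  have k0 : Continuous fun x => (1 / 2) * h1 x ^ 2 - H (h x) :=
    (continuous_const.mul (c1.pow 2)).sub cHh
  have k1 : Continuous fun x => ε * (h1 x * u1 x - deriv H (h x) * u x) := by fun_prop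
  have k2 : Continuous fun x => ε ^ 2 / 2 * (u1 x ^ 2 - B * h x ^ (q - 1) * u x ^ 2) := by fun_prop
  have k3 : Continuous fun x => ε ^ 3 / 6 * (B * ((q - 1) * h x ^ (q - 2)) * u x ^ 3) := by
    fun_prop
  have k4 : Continuous fun x =>
      ε ^ 4 / 24 * (B * ((q - 1) * ((q - 2) * h x ^ (q - 3))) * u x ^ 4) := by
    fun_prop
  have k01 := k0.fun_add k1
  have k02 := k01.fun_add k2
  have k03 := k02.fun_sub k3
  have k04 := k03.fun_sub k4
  rw [e1, intervalIntegral.integral_sub (ii k04) (ii crem),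
    intervalIntegral.integral_sub (ii k03) (ii k4), intervalIntegral.integral_sub (ii k02) (ii k3),
    intervalIntegral.integral_add (ii k01) (ii k2), intervalIntegral.integral_add (ii k0) (ii k1),
    ← e0,
    intervalIntegral.integral_const_mul, intervalIntegral.integral_const_mul,
    intervalIntegral.integral_const_mul, intervalIntegral.integral_const_mul, hfv, mul_zero,
    add_zero]
  linarith [(abs_le.1 hremint).1]

theorem eventually_poly_neg {a b c R : ℝ} (h : a < 0 ∨ a = 0 ∧ b < 0 ∨ a = 0 ∧ b = 0 ∧ c < 0) :
    ∀ᶠ ε in 𝓝[>] (0 : ℝ), ε ^ 2 * a + ε ^ 3 * b + ε ^ 4 * c + ε ^ 5 * R < 0 := by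
  have hev : ∀ f : ℝ → ℝ, Continuous f → f 0 < 0 → ∀ᶠ ε in 𝓝[>] (0 : ℝ), f ε < 0 :=
    fun f hf h0 => nhdsWithin_le_nhds (hf.continuousAt.eventually_lt_const h0)
  rcases h with h | ⟨rfl, h⟩ | ⟨rfl, rfl, h⟩
  · filter_upwards [hev (fun ε => a + ε * b + ε ^ 2 * c + ε ^ 3 * R) (by fun_prop) (by simpa),
      self_mem_nhdsWithin] with ε h1 (h2 : 0 < ε)
    have := mul_neg_of_pos_of_neg (pow_pos h2 2) h1
    linarith
  · filter_upwards [hev (fun ε => b + ε * c + ε ^ 2 * R) (by fun_prop) (by simpa),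
      self_mem_nhdsWithin] with ε h1 (h2 : 0 < ε)
    have := mul_neg_of_pos_of_neg (pow_pos h2 3) h1
    linarith
  · filter_upwards [hev (fun ε => c + ε * R) (by fun_prop) (by simpa),
      self_mem_nhdsWithin] with ε h1 (h2 : 0 < ε)
    have := mul_neg_of_pos_of_neg (pow_pos h2 4) h1
    linarith

/-- A perturbation is destabilizing as soon as the first nonvanishing one of the second, third and
fourth variations of the energy is negative. -/
theorem energyUnstableInDirection {n m : ℝ} {H u u1 : ℝ → ℝ} (hq : q = m - n + 1) (hX : 0 < X)
    (hH : IsPotential (fun y => y ^ n) (fun y => B * y ^ m) H)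
    (o : IsOscillation q B X h h1 h2) (hus : ContDiff ℝ ∞ u) (hu : ∀ x, HasDerivAt u (u1 x) x)
    (hper : Function.Periodic u X) (hmean : ∫ x in (0 : ℝ)..X, u x = 0) {a b c : ℝ}
    (ha : ∫ x in (0 : ℝ)..X, (u1 x ^ 2 - B * h x ^ (q - 1) * u x ^ 2) = a)
    (hb : ∫ x in (0 : ℝ)..X, B * ((q - 1) * h x ^ (q - 2)) * u x ^ 3 = b)
    (hc : ∫ x in (0 : ℝ)..X, B * ((q - 1) * ((q - 2) * h x ^ (q - 3))) * u x ^ 4 = c)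
    (habc : a < 0 ∨ a = 0 ∧ 0 < b ∨ a = 0 ∧ b = 0 ∧ 0 < c) :
    EnergyUnstableInDirection H X h u := by
  refine ⟨hus, hper, hmean, ?_⟩
  have hu1 : Continuous u1 := by
    have e : deriv u = u1 := funext fun x => (hu x).deriv
    rw [← e]
    exact hus.continuous_deriv (by simp)
  obtain ⟨R, hR⟩ := o.exists_energy_le hq hX hH hu hu1 hper hmean
  have hp := eventually_poly_neg (a := a / 2) (b := -b / 6) (c := -c / 24) (R := R) (by
    rcases habc with h | ⟨h, h'⟩ | ⟨h, h', h''⟩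
    · left; linarith
    · right; left; exact ⟨by rw [h, zero_div], by linarith⟩
    · right; right; exact ⟨by rw [h, zero_div], by rw [h', neg_zero, zero_div], by linarith⟩)
  filter_upwards [hR, hp] with ε h1 h2
  rw [ha, hb, hc] at h1
  linarith

end IsOscillation

/-! ### The directions given by the first and second derivatives -/

namespace IsOscillation

variable {q B X : ℝ} {h h1 h2 : ℝ → ℝ}

theorem integral_deriv_pow_four_pos (hX : 0 < X) (o : IsOscillation q B X h h1 h2)
    (hne : ¬ ∃ c : ℝ, ∀ x, h x = c) (r : ℝ) :
    0 < ∫ x in (0 : ℝ)..X, h x ^ r * h1 x ^ 4 := by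
  have c1 := o.continuous1
  have cr := o.continuous_rpow r
  refine intervalIntegral.integral_pos hX (by fun_prop) (fun x _ => ?_) ?_
  · exact mul_nonneg (Real.rpow_pos_of_pos (o.pos x) r).le (by positivity)
  · by_contra! hcon
    refine hne ⟨h 0, fun x => is_const_of_deriv_eq_zero
      (fun x => (o.deriv0 x).differentiableAt) (fun x => ?_) x 0⟩
    rw [(o.deriv0 x).deriv]
    obtain ⟨y, hy, hxy⟩ := o.periodic1.exists_mem_Ico₀ hX x
    rw [hxy]
    have h3 := hcon y ⟨hy.1, hy.2.le⟩
    by_contra hy0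
    have h4 : 0 < h1 y ^ 4 := by positivity
    exact absurd h3 (not_le.2 (mul_pos (Real.rpow_pos_of_pos (o.pos y) r) h4))

theorem hasDerivAt_flux (o : IsOscillation q B X h h1 h2) (x : ℝ) :
    HasDerivAt (fun x => B * h x ^ (q - 1) * h1 x)
      (B * ((q - 1) * h x ^ (q - 2)) * h1 x ^ 2 + B * h x ^ (q - 1) * h2 x) x := by
  refine (((o.hasDerivAt_rpow (r := q - 1) (s := q - 2) (by ring) x).const_mul B).mul
    (o.deriv1 x)).congr_deriv ?_
  ring

theorem integral_eq_zero (o : IsOscillation q B X h h1 h2) {F f : ℝ → ℝ}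
    (hF : ∀ x, HasDerivAt F (f x) x) (hf : Continuous f)
    (hFh : ∀ x y, h x = h y → h1 x = h1 y → h2 x = h2 y → F x = F y) :
    ∫ x in (0 : ℝ)..X, f x = 0 :=
  integral_eq_zero_of_hasDerivAt_periodic hF hf fun x =>
    hFh _ _ (o.periodic x) (o.periodic1 x) (o.periodic2 x)

/-- The derivative generates translations, so the second variation vanishes. The integrand of the
third is exact too, and the fourth decides. -/
theorem energyUnstableInDirection_deriv {n m s : ℝ} {H : ℝ → ℝ} (hq : q = m - n + 1)
    (hB : 0 < B) (hX : 0 < X)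
    (hH : IsPotential (fun y => y ^ n) (fun y => B * y ^ m) H)
    (o : IsOscillation q B X h h1 h2) (hne : ¬ ∃ c : ℝ, ∀ x, h x = c) (hs : ContDiff ℝ ∞ h1)
    (hs0 : s ≠ 0) (hq12 : 0 < (q - 1) * (q - 2)) :
    EnergyUnstableInDirection H X h (fun x => s * h1 x) := by
  have c0 := o.continuous0
  have c1 := o.continuous1
  have c2 := o.continuous2
  have r1 := o.continuous_rpow (q - 1)
  have r2 := o.continuous_rpow (q - 2)
  refine o.energyUnstableInDirection (u1 := fun x => s * h2 x) (a := 0) (b := 0) hq hX hH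
    (contDiff_const.mul hs) (fun x => (o.deriv1 x).const_mul s)
    (fun x => by simp only [o.periodic1 x]) ?_ ?_ ?_ rfl (Or.inr (Or.inr ⟨rfl, rfl, ?_⟩))
  · exact o.integral_eq_zero (fun x => (o.deriv0 x).const_mul s) (by fun_prop)
      fun x y h0 _ _ => by rw [h0]
  · refine o.integral_eq_zero (F := fun x => s ^ 2 * (h1 x * h2 x)) (fun x => ?_) (by fun_prop)
      fun x y h0 h1 h2 => by rw [h1, h2]
    refine (((o.deriv1 x).mul (o.deriv2 x)).const_mul (s ^ 2)).congr_deriv ?_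
    ring
  · refine o.integral_eq_zero
      (F := fun x => s ^ 3 * (h1 x * (B * h x ^ (q - 1) * h1 x) + h2 x ^ 2)) (fun x => ?_)
      (by fun_prop) fun x y h0 h1 h2 => by rw [h0, h1, h2]
    refine ((((o.deriv1 x).mul (o.hasDerivAt_flux x)).add
      ((o.deriv2 x).pow 2)).const_mul (s ^ 3)).congr_deriv ?_
    norm_num
    ring
  · have e : ∀ x, B * ((q - 1) * ((q - 2) * h x ^ (q - 3))) * (s * h1 x) ^ 4 =
        s ^ 4 * (B * ((q - 1) * (q - 2))) * (h x ^ (q - 3) * h1 x ^ 4) := fun x => by ring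
    simp only [e]
    rw [intervalIntegral.integral_const_mul]
    have := o.integral_deriv_pow_four_pos hX hne (q - 3)
    positivity

theorem second_variation_deriv2 (o : IsOscillation q B X h h1 h2) (s : ℝ) :
    ∫ x in (0 : ℝ)..X, ((s * -(B * h x ^ (q - 1) * h1 x)) ^ 2
      - B * h x ^ (q - 1) * (s * h2 x) ^ 2) =
    -(s ^ 2 * (B * ((q - 1) * (q - 2))) / 3) * ∫ x in (0 : ℝ)..X, h x ^ (q - 3) * h1 x ^ 4 := by
  have c0 := o.continuous0
  have c1 := o.continuous1
  have c2 := o.continuous2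
  have r1 := o.continuous_rpow (q - 1)
  have r3 := o.continuous_rpow (q - 3)
  -- The antiderivative comes from two integrations by parts: the flux term exchanges `(h''')²` with
  -- `h^(q-1) (h'')²`, leaving `h^(q-2) (h')² h''`, and the cubic term turns this into `h^(q-3)
  -- (h')^4`.
  have key := o.integral_eq_zero (F := fun x => s ^ 2 * (B * (q - 1) / 3 * (h x ^ (q - 2) * h1 x ^ 3)
      - (B * h x ^ (q - 1) * h1 x) * h2 x)) (f := fun x =>
      ((s * -(B * h x ^ (q - 1) * h1 x)) ^ 2 - B * h x ^ (q - 1) * (s * h2 x) ^ 2)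
      - -(s ^ 2 * (B * ((q - 1) * (q - 2))) / 3) * (h x ^ (q - 3) * h1 x ^ 4)) (fun x => ?_)
      (by fun_prop) fun x y h0 h1 h2 => by rw [h0, h1, h2]
  · rw [intervalIntegral.integral_sub (Continuous.intervalIntegrable (by fun_prop) _ _)
      (Continuous.intervalIntegrable (by fun_prop) _ _), intervalIntegral.integral_const_mul,
      sub_eq_zero] at key
    exact key
  · refine (((((o.hasDerivAt_rpow (r := q - 2) (s := q - 3) (by ring) x).mul
      ((o.deriv1 x).pow 3)).const_mul (B * (q - 1) / 3)).sub
      ((o.hasDerivAt_flux x).mul (o.deriv2 x))).const_mul (s ^ 2)).congr_deriv ?_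
    norm_num
    ring

theorem energyUnstableInDirection_deriv2 {n m s : ℝ} {H : ℝ → ℝ} (hq : q = m - n + 1)
    (hB : 0 < B) (hX : 0 < X)
    (hH : IsPotential (fun y => y ^ n) (fun y => B * y ^ m) H)
    (o : IsOscillation q B X h h1 h2) (hne : ¬ ∃ c : ℝ, ∀ x, h x = c) (hs : ContDiff ℝ ∞ h2)
    (hs0 : s ≠ 0) (hq12 : 0 < (q - 1) * (q - 2)) :
    EnergyUnstableInDirection H X h (fun x => s * h2 x) := by
  have c2 := o.continuous2
  refine o.energyUnstableInDirection hq hX hH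
    (contDiff_const.mul hs) (fun x => (o.deriv2 x).const_mul s)
    (fun x => by simp only [o.periodic2 x]) ?_ (o.second_variation_deriv2 s) rfl rfl (Or.inl ?_)
  · exact o.integral_eq_zero (fun x => (o.deriv1 x).const_mul s) (by fun_prop)
      fun x y _ h1 _ => by rw [h1]
  · have h1 := o.integral_deriv_pow_four_pos hX hne (q - 3)
    refine mul_neg_of_neg_of_pos ?_ h1
    have : 0 < s ^ 2 * (B * ((q - 1) * (q - 2))) / 3 := by positivity
    linarith

/-- At `q = 2` the second variation along `h''` vanishes, and the third is a nonzero multiple of `∫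
(h')^4`. It is odd in the direction, which is why only one sign is obtained. -/
theorem energyUnstableInDirection_neg_deriv2 {n m : ℝ} {H : ℝ → ℝ} (hq : (2 : ℝ) = m - n + 1)
    (hB : 0 < B) (hX : 0 < X)
    (hH : IsPotential (fun y => y ^ n) (fun y => B * y ^ m) H)
    (o : IsOscillation 2 B X h h1 h2) (hne : ¬ ∃ c : ℝ, ∀ x, h x = c) (hs : ContDiff ℝ ∞ h2) :
    EnergyUnstableInDirection H X h (fun x => -1 * h2 x) := by
  have c0 := o.continuous0
  have c1 := o.continuous1
  have c2 := o.continuous2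
  have er : ∀ x, h x ^ ((2 : ℝ) - 1) = h x := fun x => by norm_num
  have er2 : ∀ x, h x ^ ((2 : ℝ) - 2) = 1 := fun x => by norm_num
  refine o.energyUnstableInDirection (b := 2 / 3 * B ^ 2 * ∫ x in (0 : ℝ)..X, h x ^ (0 : ℝ) * h1 x ^ 4)
    hq hX hH
    (contDiff_const.mul hs) (fun x => (o.deriv2 x).const_mul (-1))
    (fun x => by simp only [o.periodic2 x]) ?_ (o.second_variation_deriv2 (-1)) ?_ rfl
    (Or.inr (Or.inl ⟨by simp, ?_⟩))
  · exact o.integral_eq_zero (fun x => (o.deriv1 x).const_mul (-1)) (by fun_prop)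
      fun x y _ h1 _ => by rw [h1]
  · rw [← sub_eq_zero, ← intervalIntegral.integral_const_mul]
    simp only [er2, Real.rpow_zero]
    rw [← intervalIntegral.integral_sub (Continuous.intervalIntegrable (by fun_prop) _ _)
      (Continuous.intervalIntegrable (by fun_prop) _ _)]
    refine o.integral_eq_zero
      (F := fun x => -B * (h2 x ^ 2 * h1 x + (2 / 3 * B) * (h x * h1 x ^ 3)))
      (fun x => ?_) (by fun_prop) fun x y h0 h1 h2 => by rw [h0, h1, h2]
    have d2 := o.deriv2 x
    rw [er] at d2
    refine ((((d2.pow 2).mul (o.deriv1 x)).add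
      (((o.deriv0 x).mul ((o.deriv1 x).pow 3)).const_mul (2 / 3 * B))).const_mul (-B)).congr_deriv ?_
    norm_num
    ring
  · have := o.integral_deriv_pow_four_pos hX hne 0
    positivity

end IsOscillation

/-! ### The potential well and its regularizing coordinate -/

/-- The antiderivative of `force q` vanishing at `1`, for `q > 1`. -/
def well (q y : ℝ) : ℝ := (y ^ (q + 1) / (q + 1) - y) / q + 1 / (q + 1)

theorem force_of_one_lt {q : ℝ} (hq : 1 < q) (y : ℝ) : force q y = (y ^ q - 1) / q := by
  unfold force
  rw [if_neg (by linarith)]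

theorem hasDerivAt_well {q : ℝ} (hq : 1 < q) {y : ℝ} (hy : 0 < y) :
    HasDerivAt (well q) (force q y) y := by
  rw [force_of_one_lt hq]
  have h := ((((Real.hasDerivAt_rpow_const (p := q + 1) (Or.inl hy.ne')).div_const (q + 1)).sub
    (hasDerivAt_id y)).div_const q).add_const (1 / (q + 1))
  refine h.congr_deriv ?_
  rw [add_sub_cancel_right, mul_div_cancel_left₀ _ (by linarith)]

theorem well_one {q : ℝ} (hq : 1 < q) : well q 1 = 0 := by
  unfold well
  rw [Real.one_rpow]
  field_simp
  ring

theorem force_neg {q y : ℝ} (hq : 1 < q) (hy : 0 < y) (hy1 : y < 1) : force q y < 0 := by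
  rw [force_of_one_lt hq]
  exact div_neg_of_neg_of_pos (by linarith [Real.rpow_lt_one hy.le hy1 (z := q) (by linarith)])
    (by linarith)

theorem force_pos {q y : ℝ} (hq : 1 < q) (hy1 : 1 < y) : 0 < force q y := by
  rw [force_of_one_lt hq]
  exact div_pos (by linarith [Real.one_lt_rpow hy1 (z := q) (by linarith)]) (by linarith)

theorem force_one {q : ℝ} (hq : 1 < q) : force q 1 = 0 := by
  rw [force_of_one_lt hq, Real.one_rpow, sub_self, zero_div]

theorem strictAntiOn_well {q : ℝ} (hq : 1 < q) : StrictAntiOn (well q) (Ioc 0 1) := by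
  refine strictAntiOn_of_deriv_neg (convex_Ioc 0 1)
    (fun y hy => (hasDerivAt_well hq hy.1).continuousAt.continuousWithinAt) fun y hy => ?_
  rw [interior_Ioc] at hy
  rw [(hasDerivAt_well hq hy.1).deriv]
  exact force_neg hq hy.1 hy.2

theorem strictMonoOn_well {q : ℝ} (hq : 1 < q) : StrictMonoOn (well q) (Ici 1) := by
  refine strictMonoOn_of_deriv_pos (convex_Ici 1)
    (fun y hy => (hasDerivAt_well hq (zero_lt_one.trans_le hy)).continuousAt.continuousWithinAt)
    fun y hy => ?_
  rw [interior_Ici] at hy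
  rw [(hasDerivAt_well hq (zero_lt_one.trans hy)).deriv]
  exact force_pos hq hy

theorem well_pos {q y : ℝ} (hq : 1 < q) (hy : 0 < y) (hy1 : y ≠ 1) : 0 < well q y := by
  rw [← well_one hq]
  rcases lt_or_gt_of_ne hy1 with h | h
  · exact strictAntiOn_well hq ⟨hy, h.le⟩ ⟨zero_lt_one, le_rfl⟩ h
  · exact strictMonoOn_well hq self_mem_Ici h.le h

theorem exists_le_well {q : ℝ} (hq : 1 < q) {t : ℝ} (ht : 0 ≤ t) : ∃ y, 1 < y ∧ t ≤ well q y := by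
  have hy1 : 1 ≤ (q + 1) * (1 + t) := by nlinarith
  have hyq : q ≤ (q + 1) * (1 + t) := by nlinarith
  -- With this `y`, the bound `y^q ≥ y` gives `y^(q+1)/(q+1) - y ≥ y t`, and `y ≥ q` absorbs the
  -- remaining division by `q`.
  refine ⟨(q + 1) * (1 + t), by nlinarith, ?_⟩
  have h1 : (q + 1) * (1 + t) ≤ ((q + 1) * (1 + t)) ^ q := by
    conv_lhs => rw [← Real.rpow_one ((q + 1) * (1 + t))]
    exact Real.rpow_le_rpow_of_exponent_le hy1 hq.le
  unfold well
  set y := (q + 1) * (1 + t) with hy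
  rw [Real.rpow_add_one (by positivity)]
  have h2 : y * t ≤ y ^ q * y / (q + 1) - y := by
    rw [le_sub_iff_add_le, le_div_iff₀ (by positivity)]
    calc (y * t + y) * (q + 1) = y * y := by rw [hy]; ring
      _ ≤ y ^ q * y := mul_le_mul_of_nonneg_right h1 (by positivity)
  have h3 : t ≤ y * t / q := by
    rw [le_div_iff₀ (by positivity), mul_comm]
    exact mul_le_mul_of_nonneg_right hyq ht
  have h4 : y * t / q ≤ (y ^ q * y / (q + 1) - y) / q := by gcongr
  have : 0 ≤ 1 / (q + 1) := by positivity
  linarith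

/-- The quotient `well q y / (y - 1) ^ 2`, extended to `y = 1`. -/
def wellQuotient (q : ℝ) : ℝ → ℝ := dslope (dslope (well q) 1) 1

theorem well_eq {q : ℝ} (hq : 1 < q) (y : ℝ) : well q y = (y - 1) ^ 2 * wellQuotient q y := by
  have h1 := sub_smul_dslope (well q) 1 y
  have h2 := sub_smul_dslope (dslope (well q) 1) 1 y
  rw [dslope_same, (hasDerivAt_well hq one_pos).deriv, force_one hq] at h2
  rw [well_one hq] at h1
  simp only [smul_eq_mul, sub_zero] at h1 h2
  rw [← h1, ← h2, wellQuotient]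
  ring

theorem analyticAt_well {q y : ℝ} (hy : 0 < y) : AnalyticAt ℝ (well q) y := by
  have h1 : ∀ r : ℝ, AnalyticAt ℝ (fun y : ℝ => y ^ r) y := fun r =>
    (analyticWithinAt_univ (f := fun y : ℝ => y ^ r)).1 (contDiffWithinAt_omega_iff_analyticWithinAt.1
      (Real.contDiffAt_rpow_const_of_ne hy.ne').contDiffWithinAt)
  unfold well
  exact (((h1 _).div_const).sub analyticAt_id).div_const.add analyticAt_const

/-- The well has a double zero at `1`, and passing to a difference quotient shifts its power series
there. This is what makes the signed square root smooth through the equilibrium. -/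
theorem analyticAt_wellQuotient {q y : ℝ} (hq : 1 < q) (hy : 0 < y) :
    AnalyticAt ℝ (wellQuotient q) y := by
  by_cases h : y = 1
  · subst h
    obtain ⟨p, hp⟩ := analyticAt_well (q := q) one_pos
    exact ⟨_, hp.has_fpower_series_dslope_fslope.has_fpower_series_dslope_fslope⟩
  · have h1 : AnalyticAt ℝ (fun y => well q y / (y - 1) ^ 2) y :=
      (analyticAt_well hy).div ((analyticAt_id.sub analyticAt_const).pow 2)
        (pow_ne_zero 2 (sub_ne_zero.2 h))
    refine h1.congr ?_
    filter_upwards [eventually_ne_nhds h] with z hz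
    rw [well_eq hq, mul_div_cancel_left₀ _ (pow_ne_zero 2 (sub_ne_zero.2 hz))]

/-- The value is half the second derivative of the well at `1`, and the force has slope `1` there.
-/
theorem wellQuotient_one {q : ℝ} (hq : 1 < q) : wellQuotient q 1 = 1 / 2 := by
  have ha := analyticAt_wellQuotient hq one_pos
  set g := wellQuotient q
  have hd := ha.differentiableAt.hasDerivAt
  have hd' := ha.deriv.differentiableAt.hasDerivAt
  have hs : ∀ y : ℝ, HasDerivAt (fun y : ℝ => y - 1) 1 y := fun y => (hasDerivAt_id y).sub_const 1
  have h1 : force q =ᶠ[𝓝 1] fun y => 2 * (y - 1) * g y + (y - 1) ^ 2 * deriv g y := by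
    filter_upwards [ha.eventually_analyticAt, lt_mem_nhds (one_pos (α := ℝ))] with y hya hy0
    refine (hasDerivAt_well hq hy0).unique ?_
    have e : well q = fun y => (y - 1) ^ 2 * g y := funext (well_eq hq)
    rw [e]
    refine (((hs y).pow 2).mul hya.differentiableAt.hasDerivAt).congr_deriv ?_
    norm_num
  have h2 := (hasDerivAt_force q one_pos).congr_of_eventuallyEq h1.symm
  have h3 : HasDerivAt (fun y => 2 * (y - 1) * g y + (y - 1) ^ 2 * deriv g y) (2 * g 1) 1 := by
    refine ((((hs 1).const_mul 2).mul hd).add (((hs 1).pow 2).mul hd')).congr_deriv ?_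
    norm_num
  have h4 := h2.unique h3
  rw [Real.one_rpow] at h4
  linarith

theorem wellQuotient_pos {q y : ℝ} (hq : 1 < q) (hy : 0 < y) : 0 < wellQuotient q y := by
  by_cases h : y = 1
  · rw [h, wellQuotient_one hq]; norm_num
  · have h1 := well_pos hq hy h
    rw [well_eq hq] at h1
    exact pos_of_mul_pos_right h1 (sq_nonneg _)

/-- The signed square root of twice the potential well, a smooth coordinate on `(0, ∞)`. -/
def wellRoot (q y : ℝ) : ℝ := (y - 1) * √(2 * wellQuotient q y)

theorem wellRoot_sq {q y : ℝ} (hq : 1 < q) (hy : 0 < y) : wellRoot q y ^ 2 = 2 * well q y := by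
  unfold wellRoot
  rw [mul_pow, Real.sq_sqrt (by linarith [wellQuotient_pos hq hy]), well_eq hq]
  ring

theorem contDiffAt_wellRoot {q y : ℝ} (hq : 1 < q) (hy : 0 < y) :
    ContDiffAt ℝ ∞ (wellRoot q) y := by
  have h1 : ContDiffAt ℝ ∞ (wellQuotient q) y := (analyticAt_wellQuotient hq hy).contDiffAt
  have h2 := wellQuotient_pos hq hy
  exact (contDiffAt_id.sub contDiffAt_const).mul
    ((contDiffAt_const.mul h1).sqrt (by positivity))

theorem wellRoot_mul_deriv {q y : ℝ} (hq : 1 < q) (hy : 0 < y) :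
    wellRoot q y * deriv (wellRoot q) y = force q y := by
  have h1 := ((contDiffAt_wellRoot hq hy).differentiableAt (by simp)).hasDerivAt
  have h2 : (fun y => wellRoot q y ^ 2) =ᶠ[𝓝 y] fun y => 2 * well q y := by
    filter_upwards [lt_mem_nhds hy] with z hz
    exact wellRoot_sq hq hz
  have h3 := ((h1.pow 2).congr_of_eventuallyEq h2.symm).unique ((hasDerivAt_well hq hy).const_mul 2)
  norm_num at h3
  linarith

theorem wellRoot_neg {q y : ℝ} (hq : 1 < q) (hy : 0 < y) (h : y < 1) : wellRoot q y < 0 :=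
  mul_neg_of_neg_of_pos (by linarith) (Real.sqrt_pos.2 (by linarith [wellQuotient_pos hq hy]))

theorem wellRoot_pos {q y : ℝ} (hq : 1 < q) (h : 1 < y) : 0 < wellRoot q y :=
  mul_pos (by linarith) (Real.sqrt_pos.2 (by linarith [wellQuotient_pos hq (one_pos.trans h)]))

/-- Away from `1` the root and the force have the same sign, and the force is the root times its
derivative. At `1` the derivative is the square root factor itself, equal to `1`. -/
theorem deriv_wellRoot_pos {q y : ℝ} (hq : 1 < q) (hy : 0 < y) : 0 < deriv (wellRoot q) y := by
  have h1 := wellRoot_mul_deriv hq hy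
  rcases lt_trichotomy y 1 with h | h | h
  · have h2 := force_neg hq hy h
    rw [← h1] at h2
    exact pos_of_mul_neg_right h2 (wellRoot_neg hq hy h).le
  · subst h
    have h2 : HasDerivAt (fun y => √(2 * wellQuotient q y))
        (deriv (fun y => √(2 * wellQuotient q y)) 1) 1 := by
      have h3 : DifferentiableAt ℝ (wellQuotient q) 1 :=
        (analyticAt_wellQuotient hq hy).differentiableAt
      have h2 := wellQuotient_pos hq hy
      exact ((h3.const_mul 2).sqrt (by positivity)).hasDerivAt
    have h4 := (((hasDerivAt_id (1 : ℝ)).sub_const 1).mul h2).deriv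
    have h5 : deriv (wellRoot q) 1 = 1 * √(2 * wellQuotient q 1) +
      (id 1 - 1) * deriv (fun y => √(2 * wellQuotient q y)) 1 := h4
    rw [h5, wellQuotient_one hq]
    norm_num
  · have h2 := force_pos hq h
    rw [← h1] at h2
    exact pos_of_mul_pos_right h2 (wellRoot_pos hq h).le

theorem strictMonoOn_wellRoot {q : ℝ} (hq : 1 < q) : StrictMonoOn (wellRoot q) (Ioi 0) := by
  refine strictMonoOn_of_deriv_pos (convex_Ioi 0)
    (fun y hy => (contDiffAt_wellRoot hq hy).continuousAt.continuousWithinAt) fun y hy => ?_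
  rw [interior_Ioi] at hy
  exact deriv_wellRoot_pos hq hy

theorem wellRoot_eq_neg_sqrt {q y : ℝ} (hq : 1 < q) (hy : 0 < y) (h : y < 1) :
    wellRoot q y = -√(2 * well q y) := by
  rw [← wellRoot_sq hq hy, Real.sqrt_sq_eq_abs, abs_of_neg (wellRoot_neg hq hy h), neg_neg]

theorem contDiffAt_invFunOn_wellRoot {q y : ℝ} (hq : 1 < q) (hy : 0 < y) :
    ContDiffAt ℝ ∞ (Function.invFunOn (wellRoot q) (Ioi 0)) (wellRoot q y) := by
  have hs := contDiffAt_wellRoot hq hy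
  have hd := (hs.differentiableAt (by simp)).hasDerivAt
  have hd0 := (deriv_wellRoot_pos hq hy).ne'
  have hf' := hd.hasFDerivAt_equiv hd0
  refine (hs.to_localInverse hf' (by simp)).congr_of_eventuallyEq ?_
  refine (hs.hasStrictFDerivAt' hf' (by simp)).localInverse_unique ?_
  filter_upwards [lt_mem_nhds hy] with z hz
  exact (strictMonoOn_wellRoot hq).injOn.leftInvOn_invFunOn hz

/-- `Y` is a smooth function agreeing on `(-R, R)` with the inverse of `wellRoot q`. -/
structure IsWellInverse (q R : ℝ) (Y : ℝ → ℝ) : Prop where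
  smooth : ContDiff ℝ ∞ Y
  pos : ∀ s, |s| < R → 0 < Y s
  deriv_pos : ∀ s, |s| < R → 0 < deriv Y s
  well_eq : ∀ s, |s| < R → 2 * well q (Y s) = s ^ 2
  force_mul : ∀ s, |s| < R → force q (Y s) * deriv Y s = s
  neg_sqrt : ∀ a, 0 < a → a < 1 → √(2 * well q a) < R → Y (-√(2 * well q a)) = a

theorem exists_isWellInverse {q α : ℝ} (hq : 1 < q) (hα : 0 < α) (hα1 : α < 1) :
    ∃ R Y, √(2 * well q α) < R ∧ IsWellInverse q R Y := by
  set r := √(2 * well q α) with hr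
  -- The well stays bounded as `y` tends to `0`, so the range of the root is limited on the left;
  -- the point `α / 2` provides room beyond the radius belonging to `α`.
  set T := √(2 * well q (α / 2)) with hT
  have hrT : r < T := by
    refine Real.sqrt_lt_sqrt (by linarith [well_pos hq hα hα1.ne]) ?_
    have := strictAntiOn_well hq ⟨half_pos hα, by linarith⟩ ⟨hα, hα1.le⟩ (half_lt_self hα)
    linarith
  have hr0 : 0 < r := Real.sqrt_pos.2 (by linarith [well_pos hq hα hα1.ne])
  obtain ⟨y₂, hy₂, hTy₂⟩ := exists_le_well hq (t := T ^ 2 / 2) (by positivity)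
  have hy₂' : T ≤ wellRoot q y₂ := by
    refine (pow_le_pow_iff_left₀ (Real.sqrt_nonneg _) (wellRoot_pos hq hy₂).le two_ne_zero).1 ?_
    rw [wellRoot_sq hq (one_pos.trans hy₂)]
    linarith
  set Z := Function.invFunOn (wellRoot q) (Ioi 0) with hZ
  have hsurj : ∀ s, |s| < T → ∃ y, 0 < y ∧ wellRoot q y = s := fun s hs => by
    have hle : α / 2 ≤ y₂ := by linarith
    have hsub := intermediate_value_Icc hle (f := wellRoot q) fun y hy =>
      (contDiffAt_wellRoot hq ((half_pos hα).trans_le hy.1)).continuousAt.continuousWithinAt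
    obtain ⟨y, hy, hys⟩ := hsub (show s ∈ _ from
      ⟨by rw [wellRoot_eq_neg_sqrt hq (half_pos hα) (by linarith)]; linarith [(abs_lt.1 hs).1],
        by linarith [(abs_lt.1 hs).2]⟩)
    exact ⟨y, (half_pos hα).trans_le hy.1, hys⟩
  have hleft : ∀ y, 0 < y → Z (wellRoot q y) = y := fun y hy =>
    (strictMonoOn_wellRoot hq).injOn.leftInvOn_invFunOn hy
  -- The cutoff makes the local inverse globally smooth. Its radii divide the gap between `r` and
  -- `T` into thirds, so it is `1` past `r` and vanishes before `T`.
  let χ : ContDiffBump (0 : ℝ) :=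
    ⟨(2 * r + T) / 3, (r + 2 * T) / 3, by positivity, by linarith⟩
  have hev : ∀ s, |s| < (2 * r + T) / 3 → (fun s => χ s * Z s) =ᶠ[𝓝 s] Z := fun s hs => by
    have : χ =ᶠ[𝓝 s] 1 := χ.eventuallyEq_one_of_mem_ball (by
      rw [mem_ball_zero_iff]; exact hs)
    filter_upwards [this] with t ht
    rw [ht, Pi.one_apply, one_mul]
  have hZs : ∀ s, |s| < T → ContDiffAt ℝ ∞ Z s := fun s hs => by
    obtain ⟨y, hy, rfl⟩ := hsurj s hs
    exact contDiffAt_invFunOn_wellRoot hq hy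
  have hZd : ∀ y, 0 < y → |wellRoot q y| < T →
      deriv (wellRoot q) y * deriv Z (wellRoot q y) = 1 := fun y hy hyT => by
    have h1 := ((hZs _ hyT).differentiableAt (by simp)).hasDerivAt
    have h2 := ((contDiffAt_wellRoot hq hy).differentiableAt (by simp)).hasDerivAt
    have h3 := h1.comp y h2
    have h4 : Z ∘ wellRoot q =ᶠ[𝓝 y] id := by
      filter_upwards [lt_mem_nhds hy] with z hz
      exact hleft z hz
    rw [mul_comm]
    exact (h3.congr_of_eventuallyEq h4.symm).unique (hasDerivAt_id y)
  have key : ∀ s, |s| < (2 * r + T) / 3 → ∃ y, 0 < y ∧ wellRoot q y = s ∧ χ s * Z s = y ∧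
      deriv (wellRoot q) y * deriv (fun s => χ s * Z s) s = 1 := fun s hs => by
    have hsT : |s| < T := by linarith
    obtain ⟨y, hy, rfl⟩ := hsurj s hsT
    exact ⟨y, hy, rfl, (hev _ hs).eq_of_nhds.trans (hleft y hy),
      by rw [(hev _ hs).deriv_eq]; exact hZd y hy hsT⟩
  refine ⟨(2 * r + T) / 3, fun s => χ s * Z s, by linarith, ⟨?_, ?_, ?_, ?_, ?_, ?_⟩⟩
  · refine contDiff_iff_contDiffAt.2 fun s => ?_
    by_cases hs : |s| < T
    · exact χ.contDiffAt.mul (hZs s hs)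
    · have h1 : s ∉ tsupport χ := by
        rw [χ.tsupport_eq, mem_closedBall_zero_iff, Real.norm_eq_abs]
        change ¬ |s| ≤ (r + 2 * T) / 3
        linarith
      have h2 : χ =ᶠ[𝓝 s] 0 := notMem_tsupport_iff_eventuallyEq.1 h1
      refine contDiffAt_const (c := (0 : ℝ)) |>.congr_of_eventuallyEq ?_
      filter_upwards [h2] with t ht
      rw [ht, Pi.zero_apply, zero_mul]
  · intro s hs
    obtain ⟨y, hy, -, h2, -⟩ := key s hs
    rw [h2]; exact hy
  · intro s hs
    obtain ⟨y, hy, -, -, h3⟩ := key s hs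
    exact pos_of_mul_pos_right (h3 ▸ one_pos) (deriv_wellRoot_pos hq hy).le
  · intro s hs
    obtain ⟨y, hy, h1, h2, -⟩ := key s hs
    rw [h2, ← h1, wellRoot_sq hq hy]
  · intro s hs
    obtain ⟨y, hy, h1, h2, h3⟩ := key s hs
    rw [h2, ← wellRoot_mul_deriv hq hy, mul_assoc, h3, mul_one, h1]
  · intro a ha ha1 haR
    rw [← wellRoot_eq_neg_sqrt hq ha ha1]
    obtain ⟨y, hy, h1, h2, -⟩ := key (wellRoot q a) (by
      rw [wellRoot_eq_neg_sqrt hq ha ha1, abs_neg, abs_of_nonneg (Real.sqrt_nonneg _)]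
      exact haR)
    rw [h2]
    exact (strictMonoOn_wellRoot hq).injOn hy ha h1

/-! ### Convexity properties of the well -/

/-- The difference of the two sides vanishes at `1`, and its derivative is a positive multiple of
`(y^q - 1)^3`, so it has its minimum there. -/
theorem well_ge {q y : ℝ} (hq : 1 < q) (hy : 0 < y) :
    3 * y * (y ^ q - 1) ^ 2 / (2 * q * ((2 * q + 1) * y ^ q + (q - 1))) ≤ well q y := by
  set U : ℝ → ℝ := fun y =>
    well q y - 3 * y * (y ^ q - 1) ^ 2 / (2 * q * ((2 * q + 1) * y ^ q + (q - 1))) with hU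
  have hden : ∀ y : ℝ, 0 < y → 0 < (2 * q + 1) * y ^ q + (q - 1) := fun y hy => by
    have := Real.rpow_pos_of_pos hy q
    have : 0 < (2 * q + 1) * y ^ q := by positivity
    linarith
  have hd : ∀ y : ℝ, 0 < y → HasDerivAt U ((2 * q + 1) * (q - 1) * (y ^ q - 1) ^ 3 /
      (2 * q * ((2 * q + 1) * y ^ q + (q - 1)) ^ 2)) y := fun y hy => by
    have hz : HasDerivAt (fun y : ℝ => y ^ q) (q * (y ^ q / y)) y := by
      rw [← Real.rpow_sub_one hy.ne']
      exact Real.hasDerivAt_rpow_const (Or.inl hy.ne')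
    have hD := hden y hy
    have h1 := (hasDerivAt_well hq hy).sub ((((hasDerivAt_id y).const_mul 3).mul
      ((hz.sub_const 1).pow 2)).div (((hz.const_mul (2 * q + 1)).add_const (q - 1)).const_mul (2 * q))
      (by positivity))
    refine h1.congr_deriv ?_
    rw [force_of_one_lt hq]
    simp only [id, Pi.mul_apply, Pi.pow_apply, Nat.cast_ofNat]
    generalize y ^ q = z at hD ⊢
    have hq0 : q ≠ 0 := by linarith
    have hy0 := hy.ne'
    have hD0 := hD.ne'
    norm_num
    obtain ⟨D, hDe⟩ : ∃ D, D = (2 * q + 1) * z + (q - 1) := ⟨_, rfl⟩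
    rw [← hDe] at hD0 ⊢
    field_simp
    rw [hDe]
    ring
  have hU1 : U 1 = 0 := by
    simp [hU, well_one hq]
  have hcont : ∀ y : ℝ, 0 < y → ContinuousAt U y := fun y hy => (hd y hy).continuousAt
  suffices h : 0 ≤ U y by simpa [hU] using h
  rw [← hU1]
  have hq1 : 0 < (2 * q + 1) * (q - 1) := mul_pos (by linarith) (by linarith)
  rcases le_total y 1 with h | h
  · refine antitoneOn_of_deriv_nonpos (convex_Ioc 0 1)
      (fun x hx => (hcont x hx.1).continuousWithinAt)
      (fun x hx => ?_) (fun x hx => ?_) ⟨hy, h⟩ ⟨one_pos, le_rfl⟩ h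
    · rw [interior_Ioc] at hx
      exact (hd x hx.1).differentiableAt.differentiableWithinAt
    · rw [interior_Ioc] at hx
      rw [(hd x hx.1).deriv]
      have h1 : x ^ q < 1 := Real.rpow_lt_one hx.1.le hx.2 (by linarith)
      refine div_nonpos_of_nonpos_of_nonneg (mul_nonpos_of_nonneg_of_nonpos hq1.le ?_)
        (by positivity)
      exact (Odd.pow_neg (by decide) (by linarith)).le
  · refine monotoneOn_of_deriv_nonneg (convex_Ici 1)
      (fun x hx => (hcont x (one_pos.trans_le hx)).continuousWithinAt)
      (fun x hx => ?_) (fun x hx => ?_) self_mem_Ici h h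
    · rw [interior_Ici] at hx
      exact (hd x (one_pos.trans hx)).differentiableAt.differentiableWithinAt
    · rw [interior_Ici] at hx
      rw [(hd x (one_pos.trans hx)).deriv]
      have h1 : 1 < x ^ q := Real.one_lt_rpow hx (by linarith)
      exact div_nonneg (mul_nonneg hq1.le (pow_nonneg (by linarith) 3)) (by positivity)

/-- With `W` the well and `F` its derivative, this is `(W/F²)'' ≥ 0` cleared of denominators,
Chicone's condition for a monotone period. Solving it for `W` gives `well_ge`. -/
theorem three_mul_force_sq_le {q y : ℝ} (hq : 1 < q) (hy : 0 < y) :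
    3 * y ^ (q - 1) * force q y ^ 2 ≤
      2 * well q y * (3 * (y ^ (q - 1)) ^ 2 - force q y * ((q - 1) * y ^ (q - 2))) := by
  have h := well_ge hq hy
  have hz := Real.rpow_pos_of_pos hy q
  have e2 : y ^ (q - 2) = y ^ q / y ^ 2 := by
    rw [Real.rpow_sub hy]
    norm_num
  rw [Real.rpow_sub_one hy.ne', e2, force_of_one_lt hq]
  generalize y ^ q = z at *
  have hD : 0 < (2 * q + 1) * z + (q - 1) := by
    have : 0 < (2 * q + 1) * z := by positivity
    linarith
  calc 3 * (z / y) * ((z - 1) / q) ^ 2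
      = 2 * (3 * y * (z - 1) ^ 2 / (2 * q * ((2 * q + 1) * z + (q - 1)))) *
        (z / y ^ 2 * (((2 * q + 1) * z + (q - 1)) / q)) := by
        have hD0 := hD.ne'
        generalize (2 * q + 1) * z + (q - 1) = D at hD0 ⊢
        field_simp
    _ ≤ 2 * well q y * (z / y ^ 2 * (((2 * q + 1) * z + (q - 1)) / q)) := by gcongr
    _ = _ := by
        field_simp
        ring

namespace IsWellInverse

variable {q R : ℝ} {Y : ℝ → ℝ}

theorem contDiff_deriv (hY : IsWellInverse q R Y) : ContDiff ℝ ∞ (deriv Y) := by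
  simpa using hY.smooth.iterate_deriv 1

theorem contDiff_deriv2 (hY : IsWellInverse q R Y) : ContDiff ℝ ∞ (deriv (deriv Y)) := by
  simpa using hY.smooth.iterate_deriv 2

theorem hasDerivAt (hY : IsWellInverse q R Y) (s : ℝ) : HasDerivAt Y (deriv Y s) s :=
  (hY.smooth.differentiable (by simp) s).hasDerivAt

theorem hasDerivAt_deriv (hY : IsWellInverse q R Y) (s : ℝ) :
    HasDerivAt (deriv Y) (deriv (deriv Y) s) s :=
  (hY.contDiff_deriv.differentiable (by simp) s).hasDerivAt

theorem hasDerivAt_deriv2 (hY : IsWellInverse q R Y) (s : ℝ) :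
    HasDerivAt (deriv (deriv Y)) (deriv (deriv (deriv Y)) s) s :=
  (hY.contDiff_deriv2.differentiable (by simp) s).hasDerivAt

theorem eventually_abs_lt {s : ℝ} (hs : |s| < R) : ∀ᶠ t in 𝓝 s, |t| < R :=
  continuous_abs.continuousAt.eventually_lt_const hs

theorem rpow_mul_deriv_sq (hY : IsWellInverse q R Y) {s : ℝ} (hs : |s| < R) :
    Y s ^ (q - 1) * deriv Y s ^ 2 + force q (Y s) * deriv (deriv Y) s = 1 := by
  have h1 := ((hasDerivAt_force q (hY.pos s hs)).comp s (hY.hasDerivAt s)).mul (hY.hasDerivAt_deriv s)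
  have h2 := (hasDerivAt_id s).congr_of_eventuallyEq
    ((eventually_abs_lt hs).mono fun t ht => hY.force_mul t ht)
  have h3 := h1.unique h2
  simp only [Function.comp_apply] at h3
  linarith

theorem deriv3_identity (hY : IsWellInverse q R Y) {s : ℝ} (hs : |s| < R) :
    (q - 1) * Y s ^ (q - 2) * deriv Y s ^ 3 + 3 * (Y s ^ (q - 1) * deriv Y s * deriv (deriv Y) s) +
      force q (Y s) * deriv (deriv (deriv Y)) s = 0 := by
  have h1 := (((hasDerivAt_rpow_of_eq (r := q - 1) (s := q - 2) (hY.pos s hs) (by ring)).comp s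
    (hY.hasDerivAt s)).mul ((hY.hasDerivAt_deriv s).pow 2)).add
    (((hasDerivAt_force q (hY.pos s hs)).comp s (hY.hasDerivAt s)).mul (hY.hasDerivAt_deriv2 s))
  have h2 := (hasDerivAt_const s (1 : ℝ)).congr_of_eventuallyEq
    ((eventually_abs_lt hs).mono fun t ht => hY.rpow_mul_deriv_sq ht)
  have h3 := h1.unique h2
  simp only [Function.comp_apply, Pi.pow_apply] at h3
  norm_num at h3
  linarith

theorem deriv3_nonneg_of_ne (hY : IsWellInverse q R Y) (hq : 1 < q) {s : ℝ} (hs : |s| < R)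
    (hs0 : s ≠ 0) : 0 ≤ deriv (deriv (deriv Y)) s := by
  have e1 := hY.force_mul s hs
  have e2 := hY.rpow_mul_deriv_sq hs
  have e3 := hY.deriv3_identity hs
  have e4 := hY.well_eq s hs
  have hc := three_mul_force_sq_le hq (hY.pos s hs)
  have hp := hY.deriv_pos s hs
  rw [e4] at hc
  generalize deriv (deriv (deriv Y)) s = y3 at *
  generalize deriv (deriv Y) s = y2 at *
  generalize deriv Y s = y1 at *
  generalize force q (Y s) = F at *
  generalize Y s ^ (q - 1) = F1 at *
  generalize Y s ^ (q - 2) = F2 at *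
  have hF : F ≠ 0 := by rintro rfl; simp at e1; exact hs0 e1.symm
  -- Eliminating the first two derivatives between `F(Y) Y' = s` and its derivatives leaves the
  -- Chicone expression, because `s²` is twice the well.
  have h1 : F ^ 4 * y3 = y1 * (s ^ 2 * (3 * F1 ^ 2 - F * ((q - 1) * F2)) - 3 * F1 * F ^ 2) := by
    rw [← e1]
    linear_combination F ^ 3 * e3 - 3 * F1 * y1 * F ^ 2 * e2
  have h2 : 0 ≤ F ^ 4 * y3 := by
    rw [h1]
    exact mul_nonneg hp.le (by linarith)
  exact nonneg_of_mul_nonneg_right h2 (by positivity)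

theorem deriv3_nonneg (hY : IsWellInverse q R Y) (hq : 1 < q) {s : ℝ} (hs : |s| < R) :
    0 ≤ deriv (deriv (deriv Y)) s := by
  by_cases hs0 : s = 0
  -- At the equilibrium the force vanishes and cannot be divided out, so the sign is obtained by
  -- continuity.
  · have hcont : ContinuousAt (deriv (deriv (deriv Y))) s :=
      (hY.contDiff_deriv2.continuous_deriv (by simp)).continuousAt
    refine ge_of_tendsto (hcont.tendsto.mono_left (nhdsWithin_le_nhds (s := {s}ᶜ))) ?_
    filter_upwards [nhdsWithin_le_nhds (eventually_abs_lt hs), self_mem_nhdsWithin] with t ht ht0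
    exact hY.deriv3_nonneg_of_ne hq ht fun h => ht0 (by rw [h, hs0]; rfl)
  · exact hY.deriv3_nonneg_of_ne hq hs hs0

theorem deriv2_le_deriv2 (hY : IsWellInverse q R Y) (hq : 1 < q) {s t : ℝ} (hs : |s| < R)
    (ht : |t| < R) (hst : s ≤ t) : deriv (deriv Y) s ≤ deriv (deriv Y) t := by
  have hmem : ∀ s, s ∈ Ioo (-R) R ↔ |s| < R := fun s => abs_lt.symm
  refine monotoneOn_of_deriv_nonneg (convex_Ioo (-R) R)
    hY.contDiff_deriv2.continuous.continuousOn
    (hY.contDiff_deriv2.differentiable (by simp)).differentiableOn (fun x hx => ?_)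
    ((hmem s).2 hs) ((hmem t).2 ht) hst
  rw [interior_Ioo] at hx
  exact hY.deriv3_nonneg hq ((hmem x).1 hx)

end IsWellInverse

/-! ### The family of periodic orbits in polar coordinates of the phase plane -/

theorem hasDerivAt_integral_of_continuous {g g' : ℝ → ℝ → ℝ} (hg : Continuous g.uncurry)
    (hg' : Continuous g'.uncurry) (hd : ∀ r φ, HasDerivAt (fun r => g r φ) (g' r φ) r)
    (a b r : ℝ) :
    HasDerivAt (fun r => ∫ φ in a..b, g r φ) (∫ φ in a..b, g' r φ) r := by
  have hK : IsCompact (Metric.closedBall r 1 ×ˢ uIcc a b) :=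
    (isCompact_closedBall r 1).prod isCompact_uIcc
  obtain ⟨C, hC⟩ := hK.exists_bound_of_continuousOn hg'.continuousOn
  have cg : ∀ r, Continuous (g r) := fun r => hg.comp (by fun_prop : Continuous fun φ => (r, φ))
  have cg' : ∀ r, Continuous (g' r) := fun r => hg'.comp (by fun_prop : Continuous fun φ => (r, φ))
  refine (intervalIntegral.hasDerivAt_integral_of_dominated_loc_of_deriv_le (bound := fun _ => C)
    (Metric.closedBall_mem_nhds r one_pos) (Eventually.of_forall fun r => (cg r).aestronglyMeasurable)
    ((cg r).intervalIntegrable _ _) (cg' r).aestronglyMeasurable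
    (Eventually.of_forall fun φ hφ x hx => ?_) intervalIntegrable_const
    (Eventually.of_forall fun φ hφ x hx => hd x φ)).2
  exact hC (x, φ) ⟨hx, uIoc_subset_uIcc hφ⟩

/-- The time in which the orbit of radius `r` sweeps the phase angle `θ`. -/
def travelTime (Y : ℝ → ℝ) (r θ : ℝ) : ℝ := ∫ φ in (0 : ℝ)..θ, deriv Y (-r * Real.cos φ)

/-- The derivative of `travelTime` with respect to the radius. -/
def travelTimeDeriv (Y : ℝ → ℝ) (r θ : ℝ) : ℝ :=
  ∫ φ in (0 : ℝ)..θ, -Real.cos φ * deriv (deriv Y) (-r * Real.cos φ)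

/-- The phase angle at time `t` on the orbit of radius `r`. -/
def angle (Y : ℝ → ℝ) (r t : ℝ) : ℝ := Function.invFun (travelTime Y r) t

/-- The solution of the oscillator equation whose phase plane orbit has radius `r`. -/
def orbit (Y : ℝ → ℝ) (r t : ℝ) : ℝ := Y (-r * Real.cos (angle Y r t))

theorem travelTime_zero (Y : ℝ → ℝ) (r : ℝ) : travelTime Y r 0 = 0 :=
  intervalIntegral.integral_same

namespace IsWellInverse

variable {q R r : ℝ} {Y : ℝ → ℝ}

theorem abs_mul_cos_lt (hr : |r| < R) (θ : ℝ) : |-r * Real.cos θ| < R := by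
  rw [abs_mul, abs_neg]
  exact (mul_le_of_le_one_right (abs_nonneg r) (Real.abs_cos_le_one θ)).trans_lt hr

theorem continuous_deriv (hY : IsWellInverse q R Y) : Continuous (deriv Y) :=
  hY.contDiff_deriv.continuous

theorem continuous_deriv2 (hY : IsWellInverse q R Y) : Continuous (deriv (deriv Y)) :=
  hY.contDiff_deriv2.continuous

theorem hasDerivAt_travelTime (hY : IsWellInverse q R Y) (r θ : ℝ) :
    HasDerivAt (travelTime Y r) (deriv Y (-r * Real.cos θ)) θ := by
  have h1 := hY.continuous_deriv
  have hc : Continuous fun φ => deriv Y (-r * Real.cos φ) := by fun_prop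
  exact intervalIntegral.integral_hasDerivAt_right (hc.intervalIntegrable _ _)
    hc.aestronglyMeasurable.stronglyMeasurableAtFilter hc.continuousAt

theorem hasDerivAt_travelTimeDeriv (hY : IsWellInverse q R Y) (r θ : ℝ) :
    HasDerivAt (travelTimeDeriv Y r) (-Real.cos θ * deriv (deriv Y) (-r * Real.cos θ)) θ := by
  have h1 := hY.continuous_deriv2
  have hc : Continuous fun φ => -Real.cos φ * deriv (deriv Y) (-r * Real.cos φ) := by fun_prop
  exact intervalIntegral.integral_hasDerivAt_right (hc.intervalIntegrable _ _)
    hc.aestronglyMeasurable.stronglyMeasurableAtFilter hc.continuousAt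

theorem hasDerivAt_mul_cos (r φ : ℝ) :
    HasDerivAt (fun φ => -r * Real.cos φ) (r * Real.sin φ) φ := by
  refine ((Real.hasDerivAt_cos φ).const_mul (-r)).congr_deriv ?_
  ring

theorem hasDerivAt_neg_mul (r c : ℝ) : HasDerivAt (fun r => -r * c) (-c) r := by
  refine ((hasDerivAt_id r).neg.mul_const c).congr_deriv ?_
  ring

theorem hasDerivAt_travelTime_radius (hY : IsWellInverse q R Y) (r θ : ℝ) :
    HasDerivAt (fun r => travelTime Y r θ) (travelTimeDeriv Y r θ) r := by
  have h1 := hY.continuous_deriv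
  have h2 := hY.continuous_deriv2
  refine hasDerivAt_integral_of_continuous (g := fun r φ => deriv Y (-r * Real.cos φ))
    (g' := fun r φ => -Real.cos φ * deriv (deriv Y) (-r * Real.cos φ))
    (by unfold Function.uncurry; fun_prop)
    (by unfold Function.uncurry; fun_prop) (fun r φ => ?_) _ _ _
  exact ((hY.hasDerivAt_deriv _).comp r (hasDerivAt_neg_mul r (Real.cos φ))).congr_deriv
    (mul_comm _ _)

theorem continuous_travelTimeDeriv (hY : IsWellInverse q R Y) :
    Continuous fun p : ℝ × ℝ => travelTimeDeriv Y p.1 p.2 := by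
  have h2 := hY.continuous_deriv2
  exact intervalIntegral.continuous_parametric_primitive_of_continuous
    (f := fun r φ => -Real.cos φ * deriv (deriv Y) (-r * Real.cos φ))
    (by unfold Function.uncurry; fun_prop)

theorem strictMono_travelTime (hY : IsWellInverse q R Y) (hr : |r| < R) :
    StrictMono (travelTime Y r) := by
  refine strictMono_of_deriv_pos fun θ => ?_
  rw [(hY.hasDerivAt_travelTime r θ).deriv]
  exact hY.deriv_pos _ (abs_mul_cos_lt hr θ)

theorem continuous_travelTime (hY : IsWellInverse q R Y) (r : ℝ) : Continuous (travelTime Y r) :=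
  continuous_iff_continuousAt.2 fun θ => (hY.hasDerivAt_travelTime r θ).continuousAt

theorem surjective_travelTime (hY : IsWellInverse q R Y) (hr : |r| < R) :
    Function.Surjective (travelTime Y r) := by
  have h1 := hY.continuous_deriv
  obtain ⟨m, M, hm, hmM⟩ := exists_pos_bounds_of_periodic (f := fun φ => deriv Y (-r * Real.cos φ))
    Real.two_pi_pos (by fun_prop) (fun φ => by simp only [Real.cos_add_two_pi])
    (fun φ => hY.deriv_pos _ (abs_mul_cos_lt hr φ))
  have hmono : Monotone fun θ => travelTime Y r θ - m * θ := by
    have hd : ∀ θ, HasDerivAt (fun θ => travelTime Y r θ - m * θ)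
        (deriv Y (-r * Real.cos θ) - m * 1) θ := fun θ =>
      (hY.hasDerivAt_travelTime r θ).sub ((hasDerivAt_id θ).const_mul m)
    refine monotone_of_deriv_nonneg (fun θ => (hd θ).differentiableAt) fun θ => ?_
    rw [(hd θ).deriv]
    linarith [(hmM θ).1]
  have h0 := travelTime_zero Y r
  refine (hY.continuous_travelTime r).surjective ?_ ?_
  · refine tendsto_atTop_mono' atTop ?_ (tendsto_id.const_mul_atTop hm)
    filter_upwards [eventually_ge_atTop 0] with θ hθ
    have := hmono hθ
    simp only [h0, mul_zero, sub_zero] at this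
    simpa using this
  · refine tendsto_atBot_mono' atBot ?_ (tendsto_id.const_mul_atBot hm)
    filter_upwards [eventually_le_atBot 0] with θ hθ
    have := hmono hθ
    simp only [h0, mul_zero, sub_zero] at this
    simpa using this

theorem travelTime_angle (hY : IsWellInverse q R Y) (hr : |r| < R) (t : ℝ) :
    travelTime Y r (angle Y r t) = t :=
  Function.invFun_eq (hY.surjective_travelTime hr t)

theorem angle_travelTime (hY : IsWellInverse q R Y) (hr : |r| < R) (θ : ℝ) :
    angle Y r (travelTime Y r θ) = θ :=
  (hY.strictMono_travelTime hr).injective (hY.travelTime_angle hr _)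

theorem continuous_angle (hY : IsWellInverse q R Y) (hr : |r| < R) : Continuous (angle Y r) := by
  let e := (hY.strictMono_travelTime hr).orderIsoOfSurjective _ (hY.surjective_travelTime hr)
  have : angle Y r = e.symm := by
    funext t
    rw [OrderIso.eq_symm_apply]
    exact hY.travelTime_angle hr t
  rw [this]
  exact e.symm.continuous

theorem hasDerivAt_angle (hY : IsWellInverse q R Y) (hr : |r| < R) (t : ℝ) :
    HasDerivAt (angle Y r) (deriv Y (-r * Real.cos (angle Y r t)))⁻¹ t :=
  HasDerivAt.of_local_left_inverse (hY.continuous_angle hr).continuousAt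
    (hY.hasDerivAt_travelTime r _) (hY.deriv_pos _ (abs_mul_cos_lt hr _)).ne'
    (Eventually.of_forall (hY.travelTime_angle hr))

/-- The angular speed is the reciprocal of `Y'`, so the chain rule factor `Y'` cancels and the
velocity is the second Cartesian coordinate on the circle of radius `r`. -/
theorem hasDerivAt_orbit (hY : IsWellInverse q R Y) (hr : |r| < R) (t : ℝ) :
    HasDerivAt (orbit Y r) (r * Real.sin (angle Y r t)) t := by
  have h1 := (hY.hasDerivAt (-r * Real.cos (angle Y r t))).comp t
    ((hasDerivAt_mul_cos r (angle Y r t)).comp t (hY.hasDerivAt_angle hr t))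
  refine h1.congr_deriv ?_
  have := (hY.deriv_pos _ (abs_mul_cos_lt hr (angle Y r t))).ne'
  rw [mul_left_comm, mul_inv_cancel₀ this, mul_one]

theorem force_orbit (hY : IsWellInverse q R Y) (hr : |r| < R) (t : ℝ) :
    force q (orbit Y r t) = -r * Real.cos (angle Y r t) *
      (deriv Y (-r * Real.cos (angle Y r t)))⁻¹ := by
  rw [← div_eq_mul_inv, eq_div_iff (hY.deriv_pos _ (abs_mul_cos_lt hr (angle Y r t))).ne']
  exact hY.force_mul _ (abs_mul_cos_lt hr _)

theorem hasDerivAt_orbit_deriv (hY : IsWellInverse q R Y) (hr : |r| < R) (t : ℝ) :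
    HasDerivAt (fun t => r * Real.sin (angle Y r t)) (-force q (orbit Y r t)) t := by
  have h1 := ((Real.hasDerivAt_sin (angle Y r t)).comp t (hY.hasDerivAt_angle hr t)).const_mul r
  refine h1.congr_deriv ?_
  rw [hY.force_orbit hr]
  ring

theorem orbit_pos (hY : IsWellInverse q R Y) (hr : |r| < R) (t : ℝ) : 0 < orbit Y r t :=
  hY.pos _ (abs_mul_cos_lt hr _)

theorem travelTime_two_pi_pos (hY : IsWellInverse q R Y) (hr : |r| < R) :
    0 < travelTime Y r (2 * Real.pi) := by
  rw [← travelTime_zero Y r]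
  exact hY.strictMono_travelTime hr Real.two_pi_pos

theorem travelTime_add_int_mul (hY : IsWellInverse q R Y) (r θ : ℝ) (j : ℤ) :
    travelTime Y r (θ + j * (2 * Real.pi)) =
      travelTime Y r θ + j * travelTime Y r (2 * Real.pi) := by
  have h1 := hY.continuous_deriv
  have hp : Function.Periodic (fun φ => deriv Y (-r * Real.cos φ)) (2 * Real.pi) := fun φ => by
    simp only [Real.cos_add_two_pi]
  have hi : ∀ a b, IntervalIntegrable (fun φ => deriv Y (-r * Real.cos φ)) MeasureTheory.volume a b :=
    fun a b => Continuous.intervalIntegrable (by fun_prop) _ _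
  have h2 := hp.intervalIntegral_add_zsmul_eq j θ hi
  rw [hp.intervalIntegral_add_eq θ 0, zero_add, zsmul_eq_mul, zsmul_eq_mul] at h2
  unfold travelTime
  rw [← h2, intervalIntegral.integral_add_adjacent_intervals (hi _ _) (hi _ _)]

theorem angle_add_period (hY : IsWellInverse q R Y) (hr : |r| < R) (t : ℝ) :
    angle Y r (t + travelTime Y r (2 * Real.pi)) = angle Y r t + 2 * Real.pi := by
  apply (hY.strictMono_travelTime hr).injective
  have := hY.travelTime_add_int_mul r (angle Y r t) 1
  rw [Int.cast_one, one_mul, one_mul] at this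
  rw [this, hY.travelTime_angle hr, hY.travelTime_angle hr]

theorem orbit_periodic (hY : IsWellInverse q R Y) (hr : |r| < R) :
    Function.Periodic (orbit Y r) (travelTime Y r (2 * Real.pi)) := fun t => by
  unfold orbit
  rw [hY.angle_add_period hr, Real.cos_add_two_pi]

theorem angle_zero (hY : IsWellInverse q R Y) (hr : |r| < R) : angle Y r 0 = 0 := by
  have := hY.angle_travelTime hr 0
  rwa [travelTime_zero] at this

theorem isCanonicalSolution_orbit (hY : IsWellInverse q R Y) (hr : |r| < R) :
    IsCanonicalSolution q (Y (-r)) (orbit Y r) := by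
  have e1 : deriv (orbit Y r) = fun t => r * Real.sin (angle Y r t) :=
    funext fun t => (hY.hasDerivAt_orbit hr t).deriv
  refine ⟨contDiff_of_hasDerivAt_force (q := q) (B := 1) (c := 0) (hY.orbit_pos hr)
    (hY.hasDerivAt_orbit hr) fun t => ?_, hY.orbit_pos hr,
    ⟨_, hY.travelTime_two_pi_pos hr, hY.orbit_periodic hr⟩, fun t => ?_, ?_, ?_⟩
  · rw [one_mul, zero_sub]
    exact hY.hasDerivAt_orbit_deriv hr t
  · rw [e1, (hY.hasDerivAt_orbit_deriv hr t).deriv]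
    exact neg_add_cancel (force q (orbit Y r t))
  · unfold orbit
    rw [hY.angle_zero hr, Real.cos_zero, mul_one]
  · rw [e1]
    simp [hY.angle_zero hr]

/-- `Y` is strictly increasing, so the initial value is taken again only when the cosine of the
angle is `1`, that is, after whole turns. -/
theorem exists_eq_int_mul_of_periodic (hY : IsWellInverse q R Y) (hr0 : 0 < r) (hr : |r| < R)
    {p : ℝ} (hp : Function.Periodic (orbit Y r) p) :
    ∃ j : ℤ, p = j * travelTime Y r (2 * Real.pi) := by
  have h1 : orbit Y r p = orbit Y r 0 := by rw [← hp 0, zero_add]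
  have hmono : StrictMonoOn Y (Ioo (-R) R) := by
    refine strictMonoOn_of_deriv_pos (convex_Ioo _ _) hY.smooth.continuous.continuousOn
      fun s hs => ?_
    rw [interior_Ioo] at hs
    exact hY.deriv_pos s (abs_lt.2 hs)
  have h2 := hmono.injOn (abs_lt.1 (abs_mul_cos_lt hr _)) (abs_lt.1 (abs_mul_cos_lt hr _)) h1
  have h3 : Real.cos (angle Y r p) = 1 := by
    rw [hY.angle_zero hr, Real.cos_zero] at h2
    exact mul_left_cancel₀ (neg_ne_zero.2 hr0.ne') h2
  obtain ⟨j, hj⟩ := (Real.cos_eq_one_iff _).1 h3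
  refine ⟨j, ?_⟩
  have h4 := hY.travelTime_add_int_mul r 0 j
  rw [zero_add, hj, hY.travelTime_angle hr, travelTime_zero, zero_add] at h4
  exact h4

end IsWellInverse

/-! ### Period, area and action as functions of the radius -/

theorem leastPeriod_eq {k : ℝ → ℝ} {p : ℝ} (hp : 0 < p) (hk : Function.Periodic k p)
    (h : ∀ r, Function.Periodic k r → ∃ j : ℤ, r = j * p) : leastPeriod k = p := by
  refine IsLeast.csInf_eq ⟨⟨hp, hk⟩, fun r hr => ?_⟩
  obtain ⟨j, rfl⟩ := h r hr.2
  have h1 : (0 : ℝ) < j := pos_of_mul_pos_left hr.1 hp.le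
  have h2 : (1 : ℤ) ≤ j := by exact_mod_cast h1
  have h3 : (1 : ℝ) ≤ j := by exact_mod_cast h2
  exact le_mul_of_one_le_left hp.le h3

namespace IsWellInverse

variable {q R r : ℝ} {Y : ℝ → ℝ}

theorem kSol_eq (hY : IsWellInverse q R Y) (hr : |r| < R) :
    kSol q (Y (-r)) = orbit Y r :=
  (hY.isCanonicalSolution_orbit hr).kSol_eq

theorem P_eq (hY : IsWellInverse q R Y) (hr0 : 0 < r) (hr : |r| < R) :
    P q (Y (-r)) = travelTime Y r (2 * Real.pi) := by
  unfold P
  rw [hY.kSol_eq hr]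
  exact leastPeriod_eq (hY.travelTime_two_pi_pos hr) (hY.orbit_periodic hr)
    fun p hp => hY.exists_eq_int_mul_of_periodic hr0 hr hp

theorem integral_comp_angle (hY : IsWellInverse q R Y) (hr : |r| < R) {G : ℝ → ℝ}
    (hG : Continuous G) :
    ∫ t in (0 : ℝ)..travelTime Y r (2 * Real.pi), G (angle Y r t) =
      ∫ θ in (0 : ℝ)..2 * Real.pi, G θ * deriv Y (-r * Real.cos θ) := by
  have h1 := hY.continuous_deriv
  have h2 := hY.continuous_angle hr
  have h := intervalIntegral.integral_comp_mul_deriv (a := 0) (b := 2 * Real.pi)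
    (g := fun t => G (angle Y r t)) (fun θ _ => hY.hasDerivAt_travelTime r θ)
    (by fun_prop) (by fun_prop)
  rw [travelTime_zero] at h
  rw [← h]
  simp only [Function.comp_apply, hY.angle_travelTime hr]

end IsWellInverse

/-- The area under one period of the orbit of radius `r`, as an integral over the phase angle. -/
def orbitArea (Y : ℝ → ℝ) (r : ℝ) : ℝ :=
  ∫ θ in (0 : ℝ)..2 * Real.pi, Y (-r * Real.cos θ) * deriv Y (-r * Real.cos θ)

/-- The action `∫ (k')²` of the orbit of radius `r`, as an integral over the phase angle. -/
def orbitAction (Y : ℝ → ℝ) (r : ℝ) : ℝ :=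
  ∫ θ in (0 : ℝ)..2 * Real.pi, (r * Real.sin θ) ^ 2 * deriv Y (-r * Real.cos θ)

/-- The derivative of `orbit` with respect to the radius at fixed time. -/
def orbitVariation (Y : ℝ → ℝ) (r t : ℝ) : ℝ :=
  -Real.cos (angle Y r t) * deriv Y (-r * Real.cos (angle Y r t))
    - r * Real.sin (angle Y r t) * travelTimeDeriv Y r (angle Y r t)

namespace IsWellInverse

variable {q R r : ℝ} {Y : ℝ → ℝ}

theorem A_eq (hY : IsWellInverse q R Y) (hr0 : 0 < r) (hr : |r| < R) :
    A q (Y (-r)) = orbitArea Y r := by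
  have h1 := hY.smooth.continuous
  unfold A
  rw [hY.P_eq hr0 hr, hY.kSol_eq hr]
  exact hY.integral_comp_angle hr (G := fun θ => Y (-r * Real.cos θ)) (by fun_prop)

theorem integral_deriv_sq (hY : IsWellInverse q R Y) (hr : |r| < R) :
    ∫ t in (0 : ℝ)..travelTime Y r (2 * Real.pi), (r * Real.sin (angle Y r t)) ^ 2 =
      orbitAction Y r :=
  hY.integral_comp_angle hr (G := fun θ => (r * Real.sin θ) ^ 2) (by fun_prop)

/-- Pairing the angles `φ` and `φ + π` produces `cos φ` times the increment of `Y''` from `-r cos φ`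
to `r cos φ`. This is nonnegative because `Y''` is nondecreasing. -/
theorem travelTimeDeriv_two_pi_nonneg (hY : IsWellInverse q R Y) (hq : 1 < q) (hr0 : 0 ≤ r)
    (hr : |r| < R) : 0 ≤ travelTimeDeriv Y r (2 * Real.pi) := by
  have h2 := hY.continuous_deriv2
  set g : ℝ → ℝ := fun φ => -Real.cos φ * deriv (deriv Y) (-r * Real.cos φ) with hg
  have cg : Continuous g := by rw [hg]; fun_prop
  have hp : Function.Periodic g (2 * Real.pi) := fun φ => by
    simp only [hg, Real.cos_add_two_pi]
  have e1 : travelTimeDeriv Y r (2 * Real.pi) = ∫ φ in (0 : ℝ)..2 * Real.pi, g φ := rfl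
  have e2 : ∫ φ in (0 : ℝ)..2 * Real.pi, g (φ + Real.pi) = ∫ φ in (0 : ℝ)..2 * Real.pi, g φ := by
    rw [intervalIntegral.integral_comp_add_right (fun φ => g φ) Real.pi, zero_add, add_comm]
    have := hp.intervalIntegral_add_eq Real.pi 0
    rw [zero_add] at this
    exact this
  have e3 : 0 ≤ ∫ φ in (0 : ℝ)..2 * Real.pi, (g φ + g (φ + Real.pi)) := by
    refine intervalIntegral.integral_nonneg Real.two_pi_pos.le fun φ _ => ?_
    have e : g φ + g (φ + Real.pi) = Real.cos φ *
        (deriv (deriv Y) (r * Real.cos φ) - deriv (deriv Y) (-r * Real.cos φ)) := by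
      simp only [hg, Real.cos_add_pi]
      rw [show -r * -Real.cos φ = r * Real.cos φ by ring]
      ring
    have hb2 := abs_mul_cos_lt hr φ
    have hb1 : |r * Real.cos φ| < R := by
      rw [neg_mul, abs_neg] at hb2
      exact hb2
    rw [e]
    rcases le_total 0 (Real.cos φ) with hc | hc
    · exact mul_nonneg hc (sub_nonneg.2 (hY.deriv2_le_deriv2 hq hb2 hb1 (by nlinarith)))
    · exact mul_nonneg_of_nonpos_of_nonpos hc
        (sub_nonpos.2 (hY.deriv2_le_deriv2 hq hb1 hb2 (by nlinarith)))
  rw [intervalIntegral.integral_add (cg.intervalIntegrable _ _)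
    (Continuous.intervalIntegrable (by fun_prop) _ _), e2, ← e1] at e3
  linarith

/-- This is the classical relation that the action has the period as its derivative in the energy
`r²/2`. In polar form the discrepancy is the derivative of `-r sin θ cos θ Y'`. -/
theorem hasDerivAt_orbitAction (hY : IsWellInverse q R Y) (r : ℝ) :
    HasDerivAt (orbitAction Y) (r * travelTime Y r (2 * Real.pi)) r := by
  have h1 := hY.continuous_deriv
  have h2 := hY.continuous_deriv2
  have hd := hasDerivAt_integral_of_continuous
    (g := fun r θ => (r * Real.sin θ) ^ 2 * deriv Y (-r * Real.cos θ))
    (g' := fun r θ => 2 * r * Real.sin θ ^ 2 * deriv Y (-r * Real.cos θ) +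
      (r * Real.sin θ) ^ 2 * (deriv (deriv Y) (-r * Real.cos θ) * -Real.cos θ))
    (by unfold Function.uncurry; fun_prop)
    (by unfold Function.uncurry; fun_prop) (fun r θ => ?_) 0 (2 * Real.pi) r
  · refine hd.congr_deriv ?_
    unfold travelTime
    rw [← intervalIntegral.integral_const_mul, ← sub_eq_zero, ← intervalIntegral.integral_sub
      (Continuous.intervalIntegrable (by fun_prop) _ _)
      (Continuous.intervalIntegrable (by fun_prop) _ _)]
    refine integral_eq_zero_of_hasDerivAt_periodic
      (F := fun θ => -r * Real.sin θ * Real.cos θ * deriv Y (-r * Real.cos θ)) (fun θ => ?_)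
      (by fun_prop) fun θ => by simp only [Real.cos_add_two_pi, Real.sin_add_two_pi]
    refine ((((Real.hasDerivAt_sin θ).const_mul (-r)).mul (Real.hasDerivAt_cos θ)).mul
      ((hY.hasDerivAt_deriv _).comp θ (hasDerivAt_mul_cos r θ))).congr_deriv ?_
    have := Real.sin_sq_add_cos_sq θ
    simp only [Function.comp_apply, Pi.mul_apply]
    linear_combination -r * deriv Y (-r * Real.cos θ) * this
  · refine ((((hasDerivAt_id r).mul_const (Real.sin θ)).pow 2).mul
      ((hY.hasDerivAt_deriv _).comp r (hasDerivAt_neg_mul r (Real.cos θ)))).congr_deriv ?_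
    simp only [Function.comp_apply, Pi.pow_apply, id, Nat.cast_ofNat, Nat.reduceSub, pow_one]
    ring

theorem orbitArea_eq (hY : IsWellInverse q R Y) (hq : 1 < q) (hr : |r| < R) :
    orbitArea Y r = (q + 3) / 2 * orbitAction Y r -
      (q + 1) * (r ^ 2 / 2 - 1 / (q + 1)) * travelTime Y r (2 * Real.pi) := by
  have h0 := hY.smooth.continuous
  have h1 := hY.continuous_deriv
  have ii : ∀ {f : ℝ → ℝ}, Continuous f →
    IntervalIntegrable f MeasureTheory.volume 0 (2 * Real.pi) := fun hf => hf.intervalIntegrable _ _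
  unfold orbitArea orbitAction travelTime
  rw [← intervalIntegral.integral_const_mul, ← intervalIntegral.integral_const_mul,
    ← intervalIntegral.integral_sub (ii (by fun_prop)) (ii (by fun_prop)), ← sub_eq_zero,
    ← intervalIntegral.integral_sub (ii (by fun_prop)) (ii (by fun_prop))]
  refine integral_eq_zero_of_hasDerivAt_periodic
    (F := fun θ => -1 * (Y (-r * Real.cos θ) * (r * Real.sin θ))) (fun θ => ?_)
    (by fun_prop) fun θ => by simp only [Real.cos_add_two_pi, Real.sin_add_two_pi]
  refine ((((hY.hasDerivAt _).comp θ (hasDerivAt_mul_cos r θ)).mul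
    ((Real.hasDerivAt_sin θ).const_mul r)).const_mul (-1)).congr_deriv ?_
  have hs := abs_mul_cos_lt hr θ
  have e1 := hY.force_mul _ hs
  have e2 := hY.well_eq _ hs
  -- This identity for the power law force, integrated with `∫ k F = ∫ (k')²` and conservation of
  -- energy, expresses the area by the action and the period.
  have e3 : Y (-r * Real.cos θ) * force q (Y (-r * Real.cos θ)) =
      Y (-r * Real.cos θ) - 1 + (q + 1) * well q (Y (-r * Real.cos θ)) := by
    rw [force_of_one_lt hq, well, Real.rpow_add_one (hY.pos _ hs).ne']
    field_simp
    ring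
  have e4 := Real.sin_sq_add_cos_sq θ
  have e5 : (q + 1) * (1 / (q + 1)) = 1 := mul_one_div_cancel (by linarith)
  simp only [Function.comp_apply]
  generalize 1 / (q + 1) = c at e5 ⊢
  generalize Y (-r * Real.cos θ) = y at *
  generalize deriv Y (-r * Real.cos θ) = y1 at *
  generalize Real.cos θ = C at *
  generalize Real.sin θ = S at *
  generalize well q y = W at *
  generalize force q y = F at *
  linear_combination (-y) * e1 + y1 * e3 + (q + 1) / 2 * y1 * e2 + (q + 1) / 2 * y1 * r ^ 2 * e4
    + y1 * e5

theorem hasDerivAt_orbitArea (hY : IsWellInverse q R Y) (hq : 1 < q) (hr : |r| < R) :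
    HasDerivAt (orbitArea Y) ((q + 3) / 2 * (r * travelTime Y r (2 * Real.pi)) - ((q + 1) *
      (r * travelTime Y r (2 * Real.pi)) + (q + 1) * (r ^ 2 / 2 - 1 / (q + 1)) *
        travelTimeDeriv Y r (2 * Real.pi))) r := by
  have h1 := (hY.hasDerivAt_orbitAction r).const_mul ((q + 3) / 2)
  have h2 : HasDerivAt (fun r : ℝ => (q + 1) * (r ^ 2 / 2 - 1 / (q + 1))) ((q + 1) * r) r := by
    refine ((((hasDerivAt_pow 2 r).div_const 2).sub_const (1 / (q + 1))).const_mul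
      (q + 1)).congr_deriv ?_
    norm_num
  have h3 := h1.sub (h2.mul (hY.hasDerivAt_travelTime_radius r (2 * Real.pi)))
  refine (h3.congr_of_eventuallyEq ((eventually_abs_lt hr).mono fun t ht =>
    hY.orbitArea_eq hq ht)).congr_deriv ?_
  ring

/-- Direct differentiation under the integral; equating it with the closed form above evaluates the
integral of `orbitVariation`. -/
theorem hasDerivAt_orbitArea' (hY : IsWellInverse q R Y) (r : ℝ) :
    HasDerivAt (orbitArea Y) (∫ θ in (0 : ℝ)..2 * Real.pi, -Real.cos θ *
      (deriv Y (-r * Real.cos θ) ^ 2 + Y (-r * Real.cos θ) * deriv (deriv Y) (-r * Real.cos θ))) r := by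
  have h0 := hY.smooth.continuous
  have h1 := hY.continuous_deriv
  have h2 := hY.continuous_deriv2
  refine hasDerivAt_integral_of_continuous
    (g := fun r θ => Y (-r * Real.cos θ) * deriv Y (-r * Real.cos θ))
    (g' := fun r θ => -Real.cos θ *
      (deriv Y (-r * Real.cos θ) ^ 2 + Y (-r * Real.cos θ) * deriv (deriv Y) (-r * Real.cos θ)))
    (by unfold Function.uncurry; fun_prop)
    (by unfold Function.uncurry; fun_prop) (fun r θ => ?_) 0 (2 * Real.pi) r
  refine (((hY.hasDerivAt _).comp r (hasDerivAt_neg_mul r (Real.cos θ))).mul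
    ((hY.hasDerivAt_deriv _).comp r (hasDerivAt_neg_mul r (Real.cos θ)))).congr_deriv ?_
  simp only [Function.comp_apply]
  ring

/-- This is the Leibniz rule for the area with a moving endpoint: `Y (-r)` is the value of the orbit
at the end of the period. In the angle variable it is an integration by parts. -/
theorem integral_orbitVariation (hY : IsWellInverse q R Y) (hq : 1 < q) (hr : |r| < R) :
    (∫ t in (0 : ℝ)..travelTime Y r (2 * Real.pi), orbitVariation Y r t)
      + Y (-r) * travelTimeDeriv Y r (2 * Real.pi) =
    (q + 3) / 2 * (r * travelTime Y r (2 * Real.pi)) - ((q + 1) *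
      (r * travelTime Y r (2 * Real.pi)) + (q + 1) * (r ^ 2 / 2 - 1 / (q + 1)) *
        travelTimeDeriv Y r (2 * Real.pi)) := by
  have h0 := hY.smooth.continuous
  have h1 := hY.continuous_deriv
  have h2 := hY.continuous_deriv2
  have hD : Continuous (travelTimeDeriv Y r) :=
    continuous_iff_continuousAt.2 fun θ => (hY.hasDerivAt_travelTimeDeriv r θ).continuousAt
  rw [(hY.hasDerivAt_orbitArea hq hr).unique (hY.hasDerivAt_orbitArea' r)]
  have e := hY.integral_comp_angle hr (G := fun θ => -Real.cos θ * deriv Y (-r * Real.cos θ)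
    - r * Real.sin θ * travelTimeDeriv Y r θ) (by fun_prop)
  have e' : ∫ t in (0 : ℝ)..travelTime Y r (2 * Real.pi), orbitVariation Y r t = _ := e
  rw [e']
  have hF : ∀ θ, HasDerivAt (fun θ => Y (-r * Real.cos θ) * travelTimeDeriv Y r θ)
      (deriv Y (-r * Real.cos θ) * (r * Real.sin θ) * travelTimeDeriv Y r θ +
        Y (-r * Real.cos θ) * (-Real.cos θ * deriv (deriv Y) (-r * Real.cos θ))) θ := fun θ =>
    ((hY.hasDerivAt _).comp θ (hasDerivAt_mul_cos r θ)).mul (hY.hasDerivAt_travelTimeDeriv r θ)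
  have hI := intervalIntegral.integral_eq_sub_of_hasDerivAt (a := 0) (b := 2 * Real.pi)
    (fun θ _ => hF θ) (Continuous.intervalIntegrable (by fun_prop) _ _)
  rw [Real.cos_two_pi, mul_one, show travelTimeDeriv Y r 0 = 0 from intervalIntegral.integral_same,
    mul_zero, sub_zero] at hI
  rw [← hI, ← intervalIntegral.integral_add
    (Continuous.intervalIntegrable (by fun_prop) _ _)
    (Continuous.intervalIntegrable (by fun_prop) _ _)]
  refine intervalIntegral.integral_congr fun θ _ => ?_
  ring

/-! ### Dependence of the orbit on the radius -/

/-- The angle at a fixed fraction `x` of the period is given implicitly by the travel time, whose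
angular derivative `Y'` is nonzero, so the implicit function theorem applies. -/
theorem hasDerivAt_angle_radius (hY : IsWellInverse q R Y) (hr : |r| < R) (x : ℝ) :
    HasDerivAt (fun r => angle Y r (travelTime Y r (2 * Real.pi) * x))
      ((travelTimeDeriv Y r (2 * Real.pi) * x -
        travelTimeDeriv Y r (angle Y r (travelTime Y r (2 * Real.pi) * x))) *
        (deriv Y (-r * Real.cos (angle Y r (travelTime Y r (2 * Real.pi) * x))))⁻¹) r := by
  set Θ := angle Y r (travelTime Y r (2 * Real.pi) * x) with hΘ
  have h1 := hY.continuous_deriv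
  have hne : deriv Y (-r * Real.cos Θ) ≠ 0 := (hY.deriv_pos _ (abs_mul_cos_lt hr Θ)).ne'
  let f : ℝ → ℝ → ℝ := fun r θ => travelTime Y r θ - travelTime Y r (2 * Real.pi) * x
  let f₁ : ℝ → ℝ → ℝ →L[ℝ] ℝ := fun r θ =>
    (travelTimeDeriv Y r θ - travelTimeDeriv Y r (2 * Real.pi) * x) • (1 : ℝ →L[ℝ] ℝ)
  let f₂ : ℝ → ℝ → ℝ →L[ℝ] ℝ := fun r θ => deriv Y (-r * Real.cos θ) • (1 : ℝ →L[ℝ] ℝ)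
  have toF : ∀ {g : ℝ → ℝ} {g' y : ℝ}, HasDerivAt g g' y →
      HasFDerivAt g (g' • (1 : ℝ →L[ℝ] ℝ)) y := fun {g g' y} hg => by
    refine hg.hasFDerivAt.congr_fderiv ?_
    ext
    simp
  have df₁ : ∀ᶠ v in 𝓝 (r, Θ), HasFDerivAt (f · v.2) (f₁ v.1 v.2) v.1 :=
    Eventually.of_forall fun v => toF ((hY.hasDerivAt_travelTime_radius v.1 v.2).sub
      ((hY.hasDerivAt_travelTime_radius v.1 (2 * Real.pi)).mul_const x))
  have df₂ : ∀ᶠ v in 𝓝 (r, Θ), HasFDerivAt (f v.1 ·) (f₂ v.1 v.2) v.2 :=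
    Eventually.of_forall fun v => toF ((hY.hasDerivAt_travelTime v.1 v.2).sub_const _)
  have cf₁ : ContinuousAt ↿f₁ (r, Θ) := by
    have hc := hY.continuous_travelTimeDeriv
    have hc2 : Continuous fun p : ℝ × ℝ => travelTimeDeriv Y p.1 (2 * Real.pi) :=
      hc.comp (f := fun p : ℝ × ℝ => (p.1, 2 * Real.pi)) (by fun_prop)
    exact ((hc.sub (hc2.mul continuous_const)).smul continuous_const).continuousAt
  have cf₂ : ContinuousAt ↿f₂ (r, Θ) := by
    have : Continuous fun p : ℝ × ℝ => deriv Y (-p.1 * Real.cos p.2) := by fun_prop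
    exact (this.smul continuous_const).continuousAt
  have e₂ : f₂ r Θ = (ContinuousLinearEquiv.unitsEquivAut ℝ (Units.mk0 _ hne) : ℝ →L[ℝ] ℝ) := by
    ext
    simp [f₂]
  have if₂ : (f₂ (r, Θ).1 (r, Θ).2).IsInvertible := ⟨_, e₂.symm⟩
  have hψ := hasStrictFDerivAt_implicitFunctionOfBivariate df₁ df₂ cf₁ cf₂ if₂
  have hev := eventually_apply_implicitFunctionOfBivariate df₁ df₂ cf₁ cf₂ if₂
  have h0 : f (r, Θ).1 (r, Θ).2 = 0 := by
    simp only [f, hΘ, hY.travelTime_angle hr, sub_self]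
  have heq : (fun r => angle Y r (travelTime Y r (2 * Real.pi) * x)) =ᶠ[𝓝 r]
      implicitFunctionOfBivariate df₁ df₂ cf₁ cf₂ if₂ := by
    filter_upwards [hev, eventually_abs_lt hr] with ρ h3 h4
    rw [h0] at h3
    rw [← sub_eq_zero.1 h3, hY.angle_travelTime h4]
  refine (hψ.hasFDerivAt.hasDerivAt.congr_of_eventuallyEq heq).congr_deriv ?_
  rw [e₂]
  simp [f₁]
  ring

theorem hasDerivAt_orbit_radius (hY : IsWellInverse q R Y) (hr : |r| < R) (x : ℝ) :
    HasDerivAt (fun r => orbit Y r (travelTime Y r (2 * Real.pi) * x))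
      (orbitVariation Y r (travelTime Y r (2 * Real.pi) * x) +
        travelTimeDeriv Y r (2 * Real.pi) * x *
          (r * Real.sin (angle Y r (travelTime Y r (2 * Real.pi) * x)))) r := by
  have h1 := hY.hasDerivAt_angle_radius hr x
  have h2 := (hY.hasDerivAt _).comp r ((hasDerivAt_id r).neg.mul
    ((Real.hasDerivAt_cos _).comp r h1))
  refine h2.congr_deriv ?_
  unfold orbitVariation
  have hne := (hY.deriv_pos _ (abs_mul_cos_lt hr
    (angle Y r (travelTime Y r (2 * Real.pi) * x)))).ne'
  simp only [Function.comp_apply, Pi.neg_apply, id, Pi.mul_apply]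
  generalize angle Y r (travelTime Y r (2 * Real.pi) * x) = θ at hne ⊢
  have hinv := mul_inv_cancel₀ hne
  linear_combination (r * Real.sin θ * (travelTimeDeriv Y r (2 * Real.pi) * x -
    travelTimeDeriv Y r θ)) * hinv

theorem hasDerivAt_orbitVariation (hY : IsWellInverse q R Y) (hr : |r| < R) (t : ℝ) :
    HasDerivAt (orbitVariation Y r)
      (Real.sin (angle Y r t) + force q (orbit Y r t) * travelTimeDeriv Y r (angle Y r t)) t := by
  have ha := hY.hasDerivAt_angle hr t
  have hne := (hY.deriv_pos _ (abs_mul_cos_lt hr (angle Y r t))).ne'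
  have h := ((((Real.hasDerivAt_cos _).comp t ha).neg).mul ((hY.hasDerivAt_deriv _).comp t
    ((hasDerivAt_mul_cos r _).comp t ha))).sub ((((Real.hasDerivAt_sin _).comp t ha).const_mul r).mul
      ((hY.hasDerivAt_travelTimeDeriv r _).comp t ha))
  refine h.congr_deriv ?_
  rw [hY.force_orbit hr]
  have hinv := mul_inv_cancel₀ hne
  simp only [Function.comp_apply, Pi.neg_apply]
  linear_combination Real.sin (angle Y r t) * hinv

/-- The radius derivative of a family of solutions solves the linearized equation `w'' + k^(q-1) w =
0`. It is verified through the explicit formula, so no interchange of mixed derivatives is needed.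
-/
theorem hasDerivAt_orbitVariation_deriv (hY : IsWellInverse q R Y) (hr : |r| < R) (t : ℝ) :
    HasDerivAt (fun t => Real.sin (angle Y r t) +
      force q (orbit Y r t) * travelTimeDeriv Y r (angle Y r t))
      (-(orbit Y r t ^ (q - 1) * orbitVariation Y r t)) t := by
  have ha := hY.hasDerivAt_angle hr t
  have hs := abs_mul_cos_lt hr (angle Y r t)
  have hne := (hY.deriv_pos _ hs).ne'
  have h := ((Real.hasDerivAt_sin _).comp t ha).add
    (((hasDerivAt_force q (hY.orbit_pos hr t)).comp t (hY.hasDerivAt_orbit hr t)).mul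
      ((hY.hasDerivAt_travelTimeDeriv r _).comp t ha))
  refine h.congr_deriv ?_
  have e1 : orbit Y r t ^ (q - 1) * deriv Y (-r * Real.cos (angle Y r t)) ^ 2 +
    force q (orbit Y r t) * deriv (deriv Y) (-r * Real.cos (angle Y r t)) = 1 :=
    hY.rpow_mul_deriv_sq hs
  have hinv := mul_inv_cancel₀ hne
  unfold orbitVariation
  simp only [Function.comp_apply]
  generalize deriv Y (-r * Real.cos (angle Y r t)) = y1 at *
  generalize y1⁻¹ = z at *
  linear_combination (-Real.cos (angle Y r t) * z) * e1
    + (Real.cos (angle Y r t) * orbit Y r t ^ (q - 1) * y1) * hinv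

end IsWellInverse

/-- Let `k'' = -F` with `F = (k^q - 1)/q`, and let `v` be periodic of mean zero with
`v'' + k^(q-1) v = M (l - e F)`. If `e` is positive and `l` nonpositive then the quadratic form of
the linearization is negative at `v`. -/
theorem linearized_form_neg {q T M e l : ℝ} (hq : 1 < q) (hT : 0 < T) (hM : 0 < M) (he : 0 < e)
    (hl : l ≤ 0) {k p v v1 : ℝ → ℝ} (hk : ∀ t, 0 < k t) (dk : ∀ t, HasDerivAt k (p t) t)
    (dp : ∀ t, HasDerivAt p (-force q (k t)) t) (dv : ∀ t, HasDerivAt v (v1 t) t)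
    (dv1 : ∀ t, HasDerivAt v1 (M * (l - e * force q (k t)) - k t ^ (q - 1) * v t) t)
    (kper : Function.Periodic k T) (vper : Function.Periodic v T)
    (hmean : ∫ t in (0 : ℝ)..T, v t = 0) (hp : 0 < ∫ t in (0 : ℝ)..T, p t ^ 2) :
    ∫ t in (0 : ℝ)..T, (v1 t ^ 2 - k t ^ (q - 1) * v t ^ 2) < 0 := by
  have ck : Continuous k := continuous_iff_continuousAt.2 fun t => (dk t).continuousAt
  have cp : Continuous p := continuous_iff_continuousAt.2 fun t => (dp t).continuousAt
  have cv : Continuous v := continuous_iff_continuousAt.2 fun t => (dv t).continuousAt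
  have cv1 : Continuous v1 := continuous_iff_continuousAt.2 fun t => (dv1 t).continuousAt
  have cF : Continuous fun t => force q (k t) := continuous_iff_continuousAt.2 fun t =>
    ContinuousAt.comp (f := k) (hasDerivAt_force q (hk t)).continuousAt ck.continuousAt
  have cr : Continuous fun t => k t ^ (q - 1) := ck.rpow_const fun t => Or.inl (hk t).ne'
  have pper := periodic_of_hasDerivAt dk kper
  have v1per := periodic_of_hasDerivAt dv vper
  have ii : ∀ {f : ℝ → ℝ}, Continuous f → IntervalIntegrable f MeasureTheory.volume 0 T :=
    fun hf => hf.intervalIntegrable _ _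
  have hkF : ∀ t, k t ^ (q - 1) * k t = q * force q (k t) + 1 := fun t => by
    rw [force_of_one_lt hq, ← Real.rpow_add_one (hk t).ne', sub_add_cancel]
    field_simp
    ring
  have i1 : ∫ t in (0 : ℝ)..T, (p t ^ 2 - k t * force q (k t)) = 0 := by
    refine integral_eq_zero_of_hasDerivAt_periodic (F := fun t => k t * p t) (fun t => ?_)
      (by fun_prop) fun t => by simp only [kper t, pper t]
    refine ((dk t).mul (dp t)).congr_deriv ?_
    ring
  rw [intervalIntegral.integral_sub (ii (by fun_prop)) (ii (by fun_prop)), sub_eq_zero] at i1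
  -- Testing against `k` gives `(q-1) ∫ v F = M l ∫ k - M e ∫ p²`, which is negative by the signs of
  -- `l` and `e`.
  have i2 : ∫ t in (0 : ℝ)..T, (M * l * k t - M * e * (k t * force q (k t))
      - (q - 1) * (v t * force q (k t)) - v t) = 0 := by
    refine integral_eq_zero_of_hasDerivAt_periodic (F := fun t => v1 t * k t - v t * p t)
      (fun t => ?_) (by fun_prop) fun t => by simp only [kper t, pper t, vper t, v1per t]
    refine (((dv1 t).mul (dk t)).sub ((dv t).mul (dp t))).congr_deriv ?_
    linear_combination (-v t) * hkF t
  -- Testing against `v` itself, which has mean zero, shows that the form equals `M e ∫ v F`.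
  have i3 : ∫ t in (0 : ℝ)..T, (v1 t ^ 2 - k t ^ (q - 1) * v t ^ 2
      + M * l * v t + -(M * e) * (v t * force q (k t))) = 0 := by
    refine integral_eq_zero_of_hasDerivAt_periodic (F := fun t => v t * v1 t)
      (fun t => ?_) (by fun_prop) fun t => by simp only [vper t, v1per t]
    refine ((dv t).mul (dv1 t)).congr_deriv ?_
    ring
  rw [intervalIntegral.integral_sub (ii (by fun_prop)) (ii (by fun_prop)),
    intervalIntegral.integral_sub (ii (by fun_prop)) (ii (by fun_prop)),
    intervalIntegral.integral_sub (ii (by fun_prop)) (ii (by fun_prop)),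
    intervalIntegral.integral_const_mul, intervalIntegral.integral_const_mul,
    intervalIntegral.integral_const_mul, hmean, ← i1] at i2
  rw [intervalIntegral.integral_add (ii (by fun_prop)) (ii (by fun_prop)),
    intervalIntegral.integral_add (ii (by fun_prop)) (ii (by fun_prop)),
    intervalIntegral.integral_const_mul, intervalIntegral.integral_const_mul, hmean] at i3
  have hkpos : 0 ≤ ∫ t in (0 : ℝ)..T, k t :=
    intervalIntegral.integral_nonneg hT.le fun t _ => (hk t).le
  have h1 : M * l * (∫ t in (0 : ℝ)..T, k t) ≤ 0 :=
    mul_nonpos_of_nonpos_of_nonneg (mul_nonpos_of_nonneg_of_nonpos hM.le hl) hkpos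
  have h2 : 0 < M * e * ∫ t in (0 : ℝ)..T, p t ^ 2 := by positivity
  have h3 : ∫ t in (0 : ℝ)..T, v t * force q (k t) < 0 := by
    have : (q - 1) * ∫ t in (0 : ℝ)..T, v t * force q (k t) < 0 := by linarith
    exact neg_of_mul_neg_right this (by linarith)
  have h4 : M * e * (∫ t in (0 : ℝ)..T, v t * force q (k t)) < 0 :=
    mul_neg_of_pos_of_neg (by positivity) h3
  linarith

namespace IsWellInverse

variable {q R r : ℝ} {Y : ℝ → ℝ}

theorem orbitAction_pos (hY : IsWellInverse q R Y) (hr0 : 0 < r) (hr : |r| < R) :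
    0 < orbitAction Y r := by
  have h1 := hY.continuous_deriv
  refine intervalIntegral.integral_pos Real.two_pi_pos (by fun_prop)
    (fun θ _ => mul_nonneg (sq_nonneg _) (hY.deriv_pos _ (abs_mul_cos_lt hr θ)).le)
    ⟨Real.pi / 2, ⟨by positivity, by linarith [Real.pi_pos]⟩, ?_⟩
  rw [Real.sin_pi_div_two]
  have := hY.deriv_pos _ (abs_mul_cos_lt hr (Real.pi / 2))
  positivity

theorem orbitArea_pos (hY : IsWellInverse q R Y) (hr : |r| < R) : 0 < orbitArea Y r := by
  have h0 := hY.smooth.continuous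
  have h1 := hY.continuous_deriv
  have hpos : ∀ θ, 0 < Y (-r * Real.cos θ) * deriv Y (-r * Real.cos θ) := fun θ =>
    mul_pos (hY.pos _ (abs_mul_cos_lt hr θ)) (hY.deriv_pos _ (abs_mul_cos_lt hr θ))
  exact intervalIntegral.integral_pos Real.two_pi_pos (by fun_prop) (fun θ _ => (hpos θ).le)
    ⟨0, ⟨le_rfl, Real.two_pi_pos.le⟩, hpos 0⟩

/-- The logarithmic derivative of the period exceeds that of the area. -/
theorem area_mul_deriv_le (hY : IsWellInverse q R Y) (hq : 1 < q) (hr0 : 0 < r) (hr : |r| < R) :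
    deriv (orbitArea Y) r * travelTime Y r (2 * Real.pi) ≤
      travelTimeDeriv Y r (2 * Real.pi) * orbitArea Y r := by
  rw [(hY.hasDerivAt_orbitArea hq hr).deriv, hY.orbitArea_eq hq hr]
  -- With period `T`, area `A` and action `J`, the difference `T' A - A' T` equals `(q+3)/2 T' J +
  -- (q-1)/2 r T²`; both terms are nonnegative.
  have h1 := mul_nonneg (hY.travelTimeDeriv_two_pi_nonneg hq hr0.le hr)
    (hY.orbitAction_pos hr0 hr).le
  have h2 : 0 ≤ (q + 3) / 2 * (travelTimeDeriv Y r (2 * Real.pi) * orbitAction Y r) :=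
    mul_nonneg (by linarith) h1
  have h3 : 0 ≤ (q - 1) / 2 * (r * travelTime Y r (2 * Real.pi) ^ 2) :=
    mul_nonneg (by linarith) (by positivity)
  linarith

theorem contDiff_orbitVariation (hY : IsWellInverse q R Y) (hr : |r| < R) :
    ContDiff ℝ ∞ (orbitVariation Y r) := by
  have hk := (hY.isCanonicalSolution_orbit hr).smooth
  refine contDiff_of_bootstrap (hY.hasDerivAt_orbitVariation hr)
    (hY.hasDerivAt_orbitVariation_deriv hr) fun n hn => ?_
  have hk' : ContDiff ℝ n (orbit Y r) := hk.of_le (by exact_mod_cast le_top)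
  exact ((hk'.rpow_const_of_ne fun t => (hY.orbit_pos hr t).ne').mul hn).neg

end IsWellInverse

/-! ### The second variation along the normalized family -/

theorem K_add_one {q a : ℝ} (h : Function.Periodic (kSol q a) (P q a)) (x : ℝ) :
    K q a (x + 1) = K q a x := by
  unfold K
  rw [mul_add, mul_one, h]

/-- The function `v` combines the three effects of varying `α`: the amplitude factor contributes a
multiple of `k`, the change of orbit the radius variation, and the stretching of time a multiple of
`t k'`. Substituting it into the linearized equation gives exactly the situation of
`linearized_form_neg`. -/
theorem exists_kappa_eq {q α : ℝ} (hq : 1 < q) (hα : α ∈ Ioo (0 : ℝ) 1)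
    (hE : 0 < deriv (E q) α) :
    0 < P q α ∧ Function.Periodic (kSol q α) (P q α) ∧
    (∀ p, Function.Periodic (kSol q α) p → ∃ j : ℤ, p = j * P q α) ∧
    (∀ x, DifferentiableAt ℝ (fun a => K q a x) α) ∧
    ∃ v v1 : ℝ → ℝ, (∀ x, kappa q α x = v (P q α * x)) ∧ ContDiff ℝ ∞ v ∧
      (∀ t, HasDerivAt v (v1 t) t) ∧ Function.Periodic v (P q α) ∧
      ∫ t in (0 : ℝ)..P q α, v t = 0 ∧
      ∫ t in (0 : ℝ)..P q α, (v1 t ^ 2 - kSol q α t ^ (q - 1) * v t ^ 2) < 0 := by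
  obtain ⟨R, Y, hR, hY⟩ := exists_isWellInverse hq hα.1 hα.2
  set ρ : ℝ → ℝ := fun a => √(2 * well q a) with hρ
  have hwell := hasDerivAt_well hq hα.1
  have hwpos : 0 < 2 * well q α := by linarith [well_pos hq hα.1 hα.2.ne]
  have dρ : HasDerivAt ρ (2 * force q α / (2 * √(2 * well q α))) α :=
    (hwell.const_mul 2).sqrt hwpos.ne'
  obtain ⟨r, hr⟩ : ∃ r, r = ρ α := ⟨_, rfl⟩
  have hr0 : 0 < r := by rw [hr]; exact Real.sqrt_pos.2 hwpos
  obtain ⟨ρ1, hρ1⟩ : ∃ ρ1, ρ1 = 2 * force q α / (2 * √(2 * well q α)) := ⟨_, rfl⟩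
  rw [← hρ1] at dρ
  -- Raising the minimum shrinks the orbit, so inequalities for radius derivatives reverse when
  -- rewritten in `α`.
  have hρ1neg : ρ1 < 0 := by
    rw [hρ1]
    exact div_neg_of_neg_of_pos (by linarith [force_neg hq hα.1 hα.2])
      (mul_pos two_pos (Real.sqrt_pos.2 hwpos))
  have hmem : ∀ a, 0 < a → a < 1 → ρ a < R → 0 < ρ a ∧ |ρ a| < R ∧ Y (-ρ a) = a :=
    fun a h0 h1 hR => by
      have h2 : 0 < ρ a := Real.sqrt_pos.2 (by linarith [well_pos hq h0 h1.ne])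
      exact ⟨h2, by rwa [abs_of_pos h2], hY.neg_sqrt a h0 h1 hR⟩
  have hev : ∀ᶠ a in 𝓝 α, 0 < ρ a ∧ |ρ a| < R ∧ Y (-ρ a) = a := by
    filter_upwards [lt_mem_nhds hα.1, gt_mem_nhds hα.2,
      dρ.continuousAt.eventually_lt_const (show ρ α < R from hR)] with a h0 h1 h2
    exact hmem a h0 h1 h2
  obtain ⟨-, hrR, hYr⟩ := hev.self_of_nhds
  rw [← hr] at hrR hYr
  have ek : ∀ᶠ a in 𝓝 α, kSol q a = orbit Y (ρ a) := hev.mono fun a h => by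
    rw [← hY.kSol_eq h.2.1, h.2.2]
  have eP : P q =ᶠ[𝓝 α] fun a => travelTime Y (ρ a) (2 * Real.pi) := hev.mono fun a h => by
    simp only []
    rw [← hY.P_eq h.1 h.2.1, h.2.2]
  have eA : A q =ᶠ[𝓝 α] fun a => orbitArea Y (ρ a) := hev.mono fun a h => by
    simp only []
    rw [← hY.A_eq h.1 h.2.1, h.2.2]
  have ekα : kSol q α = orbit Y r := by rw [hr]; exact ek.self_of_nhds
  have ePα : P q α = travelTime Y r (2 * Real.pi) := by rw [hr]; exact eP.self_of_nhds
  have eAα : A q α = orbitArea Y r := by rw [hr]; exact eA.self_of_nhds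
  have hTpos := hY.travelTime_two_pi_pos hrR
  have hApos := hY.orbitArea_pos hrR
  have dP : HasDerivAt (P q) (travelTimeDeriv Y r (2 * Real.pi) * ρ1) α := by
    have h1 := hY.hasDerivAt_travelTime_radius r (2 * Real.pi)
    rw [hr] at h1 ⊢
    exact (h1.comp α dρ).congr_of_eventuallyEq eP
  have dA : HasDerivAt (A q) (deriv (orbitArea Y) r * ρ1) α := by
    have h1 := (hY.hasDerivAt_orbitArea hq hrR).differentiableAt.hasDerivAt
    rw [hr] at h1 ⊢
    exact (h1.comp α dρ).congr_of_eventuallyEq eA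
  have hmean0 := hY.integral_orbitVariation hq hrR
  rw [← (hY.hasDerivAt_orbitArea hq hrR).deriv, hYr] at hmean0
  have hlam0 := hY.area_mul_deriv_le hq hr0 hrR
  have dK : ∀ x, HasDerivAt (fun a => K q a x)
      ((travelTimeDeriv Y r (2 * Real.pi) * ρ1 * A q α - P q α * (deriv (orbitArea Y) r * ρ1)) /
        A q α ^ 2 * orbit Y r (P q α * x) + P q α / A q α * ((orbitVariation Y r (P q α * x) +
        travelTimeDeriv Y r (2 * Real.pi) * x * (r * Real.sin (angle Y r (P q α * x)))) * ρ1)) α :=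
    fun x => by
      have h1 := hY.hasDerivAt_orbit_radius hrR x
      rw [← ePα] at h1
      have h2 : HasDerivAt (fun a => kSol q a (P q a * x)) ((orbitVariation Y r (P q α * x) +
        travelTimeDeriv Y r (2 * Real.pi) * x * (r * Real.sin (angle Y r (P q α * x)))) * ρ1) α := by
        rw [hr] at h1 ⊢
        refine (h1.comp α dρ).congr_of_eventuallyEq ?_
        filter_upwards [ek, eP] with a h3 h4
        rw [h3, h4]
        rfl
      have h3 := (dP.div dA (by rw [eAα]; exact hApos.ne')).mul h2
      rw [ekα] at h3
      exact h3
  rw [eAα, ePα] at dK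
  have dE := (dP.rpow_const (p := 3 - q) (Or.inl (by rw [ePα]; exact hTpos.ne'))).mul
    (dA.rpow_const (p := q - 1) (Or.inl (by rw [eAα]; exact hApos.ne')))
  have hE' := hE
  rw [show deriv (E q) α = _ from dE.deriv, ePα, eAα, Real.rpow_sub_one hTpos.ne' (3 - q),
    Real.rpow_sub_one hApos.ne' (q - 1)] at hE'
  clear dE
  have dk := hY.hasDerivAt_orbit hrR
  have dp := hY.hasDerivAt_orbit_deriv hrR
  have dw := hY.hasDerivAt_orbitVariation hrR
  have dw1 := hY.hasDerivAt_orbitVariation_deriv hrR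
  have hJ : 0 < ∫ t in (0 : ℝ)..travelTime Y r (2 * Real.pi), (r * Real.sin (angle Y r t)) ^ 2 := by
    rw [hY.integral_deriv_sq hrR]
    exact hY.orbitAction_pos hr0 hrR
  have hkper := hY.orbit_periodic hrR
  have hk0 : orbit Y r 0 = α := by
    rw [← hYr]
    exact (hY.isCanonicalSolution_orbit hrR).init
  have sk := (hY.isCanonicalSolution_orbit hrR).smooth
  have sp : ContDiff ℝ ∞ fun t => r * Real.sin (angle Y r t) := by
    have h1 : deriv (orbit Y r) = fun t => r * Real.sin (angle Y r t) :=
      funext fun t => (dk t).deriv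
    rw [← h1]
    simpa using sk.iterate_deriv 1
  have sw := hY.contDiff_orbitVariation hrR
  have hkF : ∀ t, orbit Y r t ^ (q - 1) * orbit Y r t = q * force q (orbit Y r t) + 1 := fun t => by
    rw [force_of_one_lt hq, ← Real.rpow_add_one (hY.orbit_pos hrR t).ne', sub_add_cancel]
    field_simp
    ring
  have harea : ∫ t in (0 : ℝ)..travelTime Y r (2 * Real.pi), orbit Y r t = orbitArea Y r := by
    rw [← eAα, A, ePα, ekα]
  rw [ekα, ePα]
  have hperiods : ∀ p, Function.Periodic (orbit Y r) p →
      ∃ j : ℤ, p = j * travelTime Y r (2 * Real.pi) :=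
    fun p hp => hY.exists_eq_int_mul_of_periodic hr0 hrR hp
  -- Periodicity is inherited from the functions `K` with parameter near `α`; the summand of `v`
  -- containing the factor `t` is not periodic by itself.
  have hkappa_per : ∀ x, kappa q α (x + 1) = kappa q α x := fun x => by
    refine Filter.EventuallyEq.deriv_eq ?_
    filter_upwards [hev, ek, eP] with a h1 h2 h3
    refine K_add_one ?_ x
    rw [h2, h3]
    exact hY.orbit_periodic h1.2.1
  generalize travelTime Y r (2 * Real.pi) = T at *
  generalize orbitArea Y r = Ar at *
  generalize travelTimeDeriv Y r (2 * Real.pi) = D at *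
  generalize deriv (orbitArea Y) r = Ad at *
  have hκ : ∀ x, kappa q α x = _ := fun x => (dK x).deriv
  -- `lam` and `mu` are the logarithmic derivatives in `α` of `P/A` and `P`; hence `2 mu - (q-1)
  -- lam` is that of `E`.
  set lam : ℝ := D * ρ1 / T - Ad * ρ1 / Ar with hlam
  set mu : ℝ := D * ρ1 / T with hmu
  have hlam_nonpos : lam ≤ 0 := by
    have : lam = ρ1 * ((D * Ar - Ad * T) / (T * Ar)) := by
      rw [hlam, hmu]
      field_simp
    rw [this]
    exact mul_nonpos_of_nonpos_of_nonneg hρ1neg.le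
      (div_nonneg (by linarith) (mul_pos hTpos hApos).le)
  have he1 : 0 < 2 * mu - (q - 1) * lam := by
    have h1 : 0 < T ^ (3 - q) * Ar ^ (q - 1) :=
      mul_pos (Real.rpow_pos_of_pos hTpos _) (Real.rpow_pos_of_pos hApos _)
    refine pos_of_mul_pos_right (lt_of_lt_of_eq hE' ?_) h1.le
    rw [hlam, hmu]
    field_simp
    ring
  refine ⟨hTpos, hkper, hperiods, fun x => (dK x).differentiableAt,
    fun t => T / Ar * (lam * orbit Y r t + ρ1 * orbitVariation Y r t +
      mu * (t * (r * Real.sin (angle Y r t)))),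
    fun t => T / Ar * (lam * (r * Real.sin (angle Y r t)) + ρ1 * (Real.sin (angle Y r t) +
      force q (orbit Y r t) * travelTimeDeriv Y r (angle Y r t)) +
      mu * (1 * (r * Real.sin (angle Y r t)) + t * -force q (orbit Y r t))), ?_⟩
  have hvκ : ∀ x, kappa q α x = T / Ar * (lam * orbit Y r (T * x) + ρ1 * orbitVariation Y r (T * x) +
      mu * ((T * x) * (r * Real.sin (angle Y r (T * x))))) := fun x => by
    rw [hκ x, hlam, hmu]
    field_simp
    ring
  have dv : ∀ t, HasDerivAt (fun t => T / Ar * (lam * orbit Y r t + ρ1 * orbitVariation Y r t +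
      mu * (t * (r * Real.sin (angle Y r t))))) (T / Ar * (lam * (r * Real.sin (angle Y r t)) +
      ρ1 * (Real.sin (angle Y r t) + force q (orbit Y r t) * travelTimeDeriv Y r (angle Y r t)) +
      mu * (1 * (r * Real.sin (angle Y r t)) + t * -force q (orbit Y r t)))) t := fun t =>
    ((((dk t).const_mul lam).add ((dw t).const_mul ρ1)).add
      (((hasDerivAt_id t).mul (dp t)).const_mul mu)).const_mul (T / Ar)
  have dv1 : ∀ t, HasDerivAt (fun t => T / Ar * (lam * (r * Real.sin (angle Y r t)) +
      ρ1 * (Real.sin (angle Y r t) + force q (orbit Y r t) * travelTimeDeriv Y r (angle Y r t)) +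
      mu * (1 * (r * Real.sin (angle Y r t)) + t * -force q (orbit Y r t))))
      (T / Ar * (lam - (2 * mu - (q - 1) * lam) * force q (orbit Y r t)) - orbit Y r t ^ (q - 1) *
        (T / Ar * (lam * orbit Y r t + ρ1 * orbitVariation Y r t +
        mu * (t * (r * Real.sin (angle Y r t)))))) t := fun t => by
    have hF := (hasDerivAt_force q (hY.orbit_pos hrR t)).comp t (dk t)
    refine (((((dp t).const_mul lam).add ((dw1 t).const_mul ρ1)).add
      ((((dp t).const_mul 1).add ((hasDerivAt_id t).mul hF.neg)).const_mul mu)).const_mul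
        (T / Ar)).congr_deriv ?_
    simp only [id, Pi.neg_apply, Function.comp_apply]
    linear_combination (T / Ar * lam) * hkF t
  have hvper : Function.Periodic (fun t => T / Ar * (lam * orbit Y r t + ρ1 * orbitVariation Y r t +
      mu * (t * (r * Real.sin (angle Y r t))))) T := fun t => by
    have h1 := hkappa_per (t / T)
    have e1 : T * (t / T) = t := mul_div_cancel₀ _ hTpos.ne'
    have e2 : T * (t / T + 1) = t + T := by rw [mul_add, mul_one, e1]
    rw [hvκ, hvκ, e1, e2] at h1
    exact h1
  have hvmean : ∫ t in (0 : ℝ)..T, T / Ar * (lam * orbit Y r t + ρ1 * orbitVariation Y r t +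
      mu * (t * (r * Real.sin (angle Y r t)))) = 0 := by
    have ck := sk.continuous
    have cp := sp.continuous
    have cw := sw.continuous
    have h1 := intervalIntegral.integral_eq_sub_of_hasDerivAt (a := 0) (b := T)
      (fun t _ => (hasDerivAt_id t).mul (dk t)) (Continuous.intervalIntegrable (by
        simp only [id]; fun_prop) _ _)
    have hkT : orbit Y r T = α := by rw [← hk0, ← hkper 0, zero_add]
    simp only [Pi.mul_apply, id, zero_mul, sub_zero, one_mul, hkT] at h1
    have ii : ∀ {f : ℝ → ℝ}, Continuous f → IntervalIntegrable f MeasureTheory.volume 0 T :=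
      fun hf => hf.intervalIntegrable _ _
    rw [intervalIntegral.integral_add (ii ck) (ii (by fun_prop)), harea] at h1
    rw [intervalIntegral.integral_const_mul,
      intervalIntegral.integral_add (ii (by fun_prop)) (ii (by fun_prop)),
      intervalIntegral.integral_add (ii (by fun_prop)) (ii (by fun_prop)),
      intervalIntegral.integral_const_mul, intervalIntegral.integral_const_mul,
      intervalIntegral.integral_const_mul, harea]
    -- The mean vanishes because every `K` has mean one. In the explicit formula, the Leibniz rule
    -- for the area and the boundary term `α T` of `∫ t k'` cancel.
    have h2 : lam * Ar = mu * Ar - Ad * ρ1 := by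
      rw [hlam, hmu]
      field_simp
    have h3 : mu * T = D * ρ1 := by
      rw [hmu]
      field_simp
    refine mul_eq_zero_of_right _ ?_
    linear_combination h2 + ρ1 * hmean0 + mu * h1 + α * h3
  exact ⟨hvκ, contDiff_const.mul (((contDiff_const.mul sk).add (contDiff_const.mul sw)).add
    (contDiff_const.mul (contDiff_id.mul sp))), dv, hvper, hvmean,
    linearized_form_neg hq hTpos (div_pos hTpos hApos) he1 hlam_nonpos (hY.orbit_pos hrR) dk dp dv dv1
      hkper hvper hvmean hJ⟩

/-! ### The direction `κ` -/

theorem integral_comp_sub_div_of_periodic {g : ℝ → ℝ} {T c x₀ : ℝ} (hg : Continuous g)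
    (hT : Function.Periodic g T) (hc : c ≠ 0) (j : ℤ) :
    ∫ x in (0 : ℝ)..c * (j * T), g ((x - x₀) / c) = c * (j * ∫ t in (0 : ℝ)..T, g t) := by
  have e : ∀ x, g ((x - x₀) / c) = g (x / c - x₀ / c) := fun x => by rw [sub_div]
  simp only [e]
  rw [intervalIntegral.integral_comp_div_sub g hc, zero_div, zero_sub, mul_div_cancel_left₀ _ hc,
    smul_eq_mul]
  have h1 := hT.intervalIntegral_add_zsmul_eq j (-(x₀ / c)) fun a b => hg.intervalIntegrable _ _
  rw [hT.intervalIntegral_add_eq _ 0, zero_add, zsmul_eq_mul, zsmul_eq_mul] at h1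
  rw [← h1, sub_eq_neg_add]

/-- The second variation is quadratic, so its sign does not depend on `s`, and it scales by a
positive factor when passing from `k` to `h`. -/
theorem energyUnstableInDirection_kappa {n m B X q α s : ℝ} {H h h1 h2 : ℝ → ℝ} {x₀ : ℝ}
    (hq : q = m - n + 1) (hB : 0 < B) (hX : 0 < X)
    (hH : IsPotential (fun y => y ^ n) (fun y => B * y ^ m) H)
    (o : IsOscillation q B X h h1 h2) (hq1 : 1 < q) (hα : α ∈ Ioo (0 : ℝ) 1)
    (hE : 0 < deriv (E q) α) (hresc : RescalesTo q B (fun x => h (x + x₀)) α) (hs : s ≠ 0) :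
    EnergyUnstableInDirection H X h (fun x => s * kappa q α ((x - x₀) / leastPeriod h)) := by
  obtain ⟨hP, hkper, hperiods, -, v, v1, hκ, sv, dv, hvper, hvmean, hneg⟩ :=
    exists_kappa_eq hq1 hα hE
  obtain ⟨D, hD, -, hk⟩ := hresc
  obtain ⟨b, c, hb, hc, hbc, hbcB, -⟩ := exists_rescale_eq q hB hD
  have hkh : ∀ x, kSol q α x = b * h (c * x + x₀) := fun x => by rw [← hk, hbc]
  have hh : ∀ y, kSol q α ((y - x₀) / c) = b * h y := fun y => by
    rw [hkh, mul_div_cancel₀ _ hc.ne', sub_add_cancel]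
  have hper_iff : ∀ p, Function.Periodic h p → ∃ j : ℤ, p = c * (j * P q α) := fun p hp => by
    obtain ⟨j, hj⟩ := hperiods (p / c) fun x => by
      rw [hkh, hkh, mul_add, mul_div_cancel₀ _ hc.ne', add_right_comm, hp]
    exact ⟨j, by rw [← hj, mul_div_cancel₀ _ hc.ne']⟩
  have hleast : leastPeriod h = c * P q α := by
    refine leastPeriod_eq (mul_pos hc hP) (fun y => ?_) fun p hp => ?_
    · refine mul_left_cancel₀ hb.ne' ?_
      rw [← hh, ← hh, add_sub_right_comm, add_div, mul_div_cancel_left₀ _ hc.ne', hkper]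
    · obtain ⟨j, hj⟩ := hper_iff p hp
      exact ⟨j, by rw [hj]; ring⟩
  -- `X` need not be the least period; integrals over `X` are `j` times those over one least period.
  obtain ⟨j, hj⟩ := hper_iff X o.periodic
  have hj0 : (0 : ℝ) < j := by
    rw [hj] at hX
    exact pos_of_mul_pos_left (pos_of_mul_pos_right hX hc.le) hP.le
  have hu : (fun x => s * kappa q α ((x - x₀) / leastPeriod h)) =
      fun x => s * v ((x - x₀) / c) := by
    funext x
    rw [hκ, hleast]
    congr 2
    field_simp
  rw [hu]
  have dl : ∀ x, HasDerivAt (fun x => (x - x₀) / c) (1 / c) x := fun x =>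
    ((hasDerivAt_id x).sub_const x₀).div_const c
  have du : ∀ x, HasDerivAt (fun x => s * v ((x - x₀) / c)) (s * (v1 ((x - x₀) / c) * (1 / c))) x :=
    fun x => ((dv _).comp x (dl x)).const_mul s
  have cv1 : Continuous v1 := by
    rw [← funext fun t => (dv t).deriv]
    exact sv.continuous_deriv (by simp)
  have cv := sv.continuous
  have hkpos : ∀ t, 0 < kSol q α t := fun t => by
    rw [hkh]; exact mul_pos hb (o.pos _)
  have ckr : Continuous fun t => kSol q α t ^ (q - 1) := by
    refine Continuous.rpow_const ?_ fun t => Or.inl (hkpos t).ne'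
    have := o.continuous0
    rw [funext hkh]
    fun_prop
  refine o.energyUnstableInDirection hq hX hH (contDiff_const.mul (sv.comp
    ((contDiff_id.sub contDiff_const).div_const c))) du (fun x => ?_) ?_ rfl rfl rfl (Or.inl ?_)
  · have : (x + X - x₀) / c = (x - x₀) / c + j * P q α := by
      rw [hj]
      field_simp
      ring
    simp only [this, hvper.int_mul j _]
  · rw [intervalIntegral.integral_const_mul, hj,
      integral_comp_sub_div_of_periodic cv hvper hc.ne', hvmean]
    ring
  · have hpt : ∀ x, (s * (v1 ((x - x₀) / c) * (1 / c))) ^ 2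
        - B * h x ^ (q - 1) * (s * v ((x - x₀) / c)) ^ 2 =
        (fun t => s ^ 2 / c ^ 2 * (v1 t ^ 2 - kSol q α t ^ (q - 1) * v t ^ 2)) ((x - x₀) / c) :=
      fun x => by
        simp only [hh]
        -- The relation `b c² B = b^q` gives `(b h)^(q-1) = c² B h^(q-1)`, so the two terms of the
        -- form scale alike.
        rw [Real.mul_rpow hb.le (o.pos x).le, Real.rpow_sub_one hb.ne', ← hbcB]
        field_simp
    have key := integral_comp_sub_div_of_periodic (x₀ := x₀) (c := c)
      (g := fun t => s ^ 2 / c ^ 2 * (v1 t ^ 2 - kSol q α t ^ (q - 1) * v t ^ 2)) (T := P q α)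
      (by fun_prop) (fun t => by
        simp only [hvper t, hkper t, periodic_of_hasDerivAt dv hvper t]) hc.ne' j
    simp only [hpt]
    rw [hj]
    refine lt_of_eq_of_lt key ?_
    rw [intervalIntegral.integral_const_mul]
    refine mul_neg_of_pos_of_neg hc (mul_neg_of_pos_of_neg hj0 (mul_neg_of_pos_of_neg ?_ hneg))
    positivity

end ThinFilm

end

/-! ### The main theorem -/

theorem mainTheorem7
    (n m B X q : ℝ) (hB : 0 < B) (hX : 0 < X) (hq : q = m - n + 1)
    (H : ℝ → ℝ)
    (hH : ThinFilm.IsPotential (fun y => y ^ n) (fun y => B * y ^ m) H)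
    (h : ℝ → ℝ) (h_smooth : ContDiff ℝ 4 h) (h_pos : ∀ x, 0 < h x)
    (h_per : Function.Periodic h X) (h_nonconst : ¬ ∃ c : ℝ, ∀ x, h x = c)
    (h_steady : ThinFilm.IsSteadyState (fun y => y ^ n) (fun y => B * y ^ m) h)
    (x₀ : ℝ) (hx₀ : ∀ x, h x₀ ≤ h x) :
    (∃! α : ℝ, α ∈ Set.Ioo (0 : ℝ) 1 ∧ ThinFilm.RescalesTo q B (fun x => h (x + x₀)) α) ∧
    (q < 1 ∨ 2 < q →
      ThinFilm.EnergyUnstableInDirection H X h (fun x => deriv h x) ∧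
      ThinFilm.EnergyUnstableInDirection H X h (fun x => -deriv h x) ∧
      ThinFilm.EnergyUnstableInDirection H X h (fun x => deriv (deriv h) x) ∧
      ThinFilm.EnergyUnstableInDirection H X h (fun x => -deriv (deriv h) x)) ∧
    (q = 2 →
      ThinFilm.EnergyUnstable H X h ∧
      ThinFilm.EnergyUnstableInDirection H X h (fun x => -deriv (deriv h) x)) ∧
    (∀ α ∈ Set.Ioo (0 : ℝ) 1, ThinFilm.RescalesTo q B (fun x => h (x + x₀)) α →
      1 < q → 0 < deriv (ThinFilm.E q) α →
        ThinFilm.EnergyUnstable H X h ∧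
        (∀ x, DifferentiableAt ℝ (fun a => ThinFilm.K q a x) α) ∧
        ThinFilm.EnergyUnstableInDirection H X h
          (fun x => ThinFilm.kappa q α ((x - x₀) / ThinFilm.leastPeriod h)) ∧
        ThinFilm.EnergyUnstableInDirection H X h
          (fun x => -ThinFilm.kappa q α ((x - x₀) / ThinFilm.leastPeriod h))) := by
  obtain ⟨c, hc⟩ := ThinFilm.exists_deriv2_add_force_eq_const hX hq h_smooth h_pos h_per h_steady
  have d0 : ∀ x, HasDerivAt h (deriv h x) x := fun x =>
    (h_smooth.differentiable (by simp) x).hasDerivAt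
  obtain ⟨D, hD, hosc⟩ := ThinFilm.exists_osc hB hX d0 h_pos h_per hc
  -- Bootstrapping from `C^4` is needed because the directions `h'` and `h''` must be smooth.
  have hs : ContDiff ℝ ∞ h := ThinFilm.contDiff_of_hasDerivAt_force h_pos d0 hc
  have hs1 : ContDiff ℝ ∞ (deriv h) := by simpa using hs.iterate_deriv 1
  have hs2 : ContDiff ℝ ∞ (deriv (deriv h)) := by simpa using hs.iterate_deriv 2
  have o : ThinFilm.IsOscillation q B X h (deriv h) (deriv (deriv h)) := by
    refine ⟨h_pos, h_per, d0, fun x => (hs1.differentiable (by simp) x).hasDerivAt, fun x => ?_⟩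
    rw [funext fun x => (hc x).deriv]
    refine ((((ThinFilm.hasDerivAt_force q (h_pos x)).comp x (d0 x)).const_mul B).const_sub c).congr_deriv ?_
    ring
  refine ⟨?_, fun hq12 => ?_, ?_, fun α hα hresc hq1 hE => ?_⟩
  · have e1 : deriv (fun x => h (x + x₀)) = fun x => deriv h (x + x₀) :=
      funext fun x => deriv_comp_add_const h x₀ x
    refine ThinFilm.existsUnique_rescalesTo hB hX hD (fun x => h_pos _) (fun x => ?_) ?_ (fun x => ?_)
      (fun x => ?_) fun x => ?_
    · simp only [add_right_comm x X x₀, h_per (x + x₀)]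
    · rintro ⟨C, hC⟩
      exact h_nonconst ⟨C, fun x => by simpa using hC (x - x₀)⟩
    · rw [e1]
      exact (d0 (x + x₀)).comp_add_const x x₀
    · rw [e1]
      exact (hosc (x + x₀)).comp_add_const x x₀
    · simpa using hx₀ (x + x₀)
  · have h12 : 0 < (q - 1) * (q - 2) := by
      rcases hq12 with h | h <;> nlinarith
    have a1 := o.energyUnstableInDirection_deriv (s := 1) hq hB hX hH h_nonconst hs1 one_ne_zero h12
    have a2 := o.energyUnstableInDirection_deriv (s := -1) hq hB hX hH h_nonconst hs1 (by simp) h12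
    have a3 := o.energyUnstableInDirection_deriv2 (s := 1) hq hB hX hH h_nonconst hs2 one_ne_zero h12
    have a4 := o.energyUnstableInDirection_deriv2 (s := -1) hq hB hX hH h_nonconst hs2 (by simp) h12
    simp only [one_mul, neg_mul] at a1 a2 a3 a4
    exact ⟨a1, a2, a3, a4⟩
  · rintro rfl
    have a := o.energyUnstableInDirection_neg_deriv2 hq hB hX hH h_nonconst hs2
    simp only [one_mul, neg_mul] at a
    exact ⟨⟨_, a⟩, a⟩
  · have a1 := ThinFilm.energyUnstableInDirection_kappa (s := 1) hq hB hX hH o hq1 hα hE hresc one_ne_zero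
    have a2 := ThinFilm.energyUnstableInDirection_kappa (s := -1) hq hB hX hH o hq1 hα hE hresc (by simp)
    simp only [one_mul, neg_mul] at a1 a2
    obtain ⟨-, -, -, hdiff, -⟩ := ThinFilm.exists_kappa_eq hq1 hα hE
    exact ⟨⟨_, a1⟩, hdiff, a1, a2⟩
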